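/- **Setting.** Let $G=(V,E)$ be a simple graph on $V=[n]$ in which every vertex has degree at most $d$, where $d\ge 1$. The random walk on $G$ is lazy: at a vertex $u$ it stays at $u$ with probability $1/2$, and otherwise it picks $k\in[d]$ uniformly and moves to the $k$-th neighbour of $u$, staying at $u$ if there is none. Thus each neighbour of $u$ is visited with probability $1/(2d)$, and the walk stays at $u$ with probability $1-\deg(u)/(2d)$. Write $p_{s,t}(v)$ for the probability that a walk of length $t$ from $s$ ends at $v$. Fix $\delta>0$ and let $\ell=n^{5\delta}$, rounded down or up to an integer. For $S\subseteq V$, $s,u\in S$ and $i\in\mathbb N=\{0,1,2,\dots\}$, let $q^{(i)}_{[S],s}(u)$ be the probability that a walk of length $2^i\ell$ from $s$ ends at $u$ and is at a vertex of $S$ at its $j\ell$-th step for every $1\le j\le 2^i$. Let $\mathbf q^{(i)}_{[S],s}=(q^{(i)}_{[S],s}(u))_{u\in S}$. For disjoint $A,B\subseteq V$ let $E(A,B)$ be the number of edges with one end in $A$ and the other in $B$. **Lemma (local partitioning).** For every $\delta>0$ there is $n_0=n_0(\delta)$ such that the following holds for all $n\ge n_0$, all $d\ge1$, all $G$ as above,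 and all $\alpha\ge n^{-\delta/2}$. Let $i\in\mathbb N$ and $S\subseteq V$ be such that $$\|\mathbf q^{(i)}_{[S],s}\|_2^2\le \frac1{n^{\delta(i-1)}}\qquad\text{for all } s\in S,$$ and let $$S'=\Big\{s\in S:\ \|\mathbf q^{(i+1)}_{[S],s}\|_2^2\ge \frac1{n^{\delta i}}\Big\}.$$ If $|S'|\ge\alpha n$, then there is $\widetilde S\subseteq S'$ with $|\widetilde S|\ge \alpha n/8$ such that for every $s\in\widetilde S$ there is a nonempty set $P_s\subseteq S$ with * $E(P_s,S\setminus P_s)\le 2n^{-\delta/4}\,d\,|P_s|$, and * for every $v\in P_s$ there is an integer $0\le t\le 160\,n^{\delta(i+7)}/\alpha$ with $p_{s,t}(v)\ge \alpha/n^{\delta(2i+14)}$. -/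

import Mathlib

namespace LocalPartition

variable {V : Type*} [Fintype V] [DecidableEq V]

/-- One step of the lazy random walk on a graph of degree bound `d`. From `u` the walk stays put with
probability `1/2`; otherwise it picks a uniform index in `[d]` and moves to the corresponding
neighbour of `u`, or stays put if `u` has no such neighbour. Hence every neighbour is visited with
probability `1/(2d)`, and the remaining mass `1 - deg(u)/(2d)` stays at `u`. -/
noncomputable def stepProb (G : SimpleGraph V) [DecidableRel G.Adj] (d : ℕ) (u v : V) : ℝ :=
  if u = v then 1 - (G.degree u : ℝ) / (2 * d)
  else if G.Adj u v then 1 / (2 * d)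
  else 0

/-- The probability that the lazy walk started at `w 0` follows the trajectory
`w 0, w 1, …, w t`. -/
noncomputable def trajectoryProb (G : SimpleGraph V) [DecidableRel G.Adj] (d : ℕ) {t : ℕ}
    (w : Fin (t + 1) → V) : ℝ :=
  ∏ k : Fin t, stepProb G d (w k.castSucc) (w k.succ)

open Classical in
/-- The probability that the trajectory of a `t`-step lazy walk from `s` has the property `A`. -/
noncomputable def walkProb (G : SimpleGraph V) [DecidableRel G.Adj] (d t : ℕ) (s : V)
    (A : (Fin (t + 1) → V) → Prop) : ℝ :=
  ∑ w : Fin (t + 1) → V with w 0 = s ∧ A w, trajectoryProb G d w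

/-- `p_{s,t}(v)`: the probability that a `t`-step lazy walk from `s` ends at `v`. -/
noncomputable def reachProb (G : SimpleGraph V) [DecidableRel G.Adj] (d t : ℕ) (s v : V) : ℝ :=
  walkProb G d t s (fun w => w (Fin.last t) = v)

/-- The `S`-returning probability at level `i` with base length `ℓ`: the probability that a lazy
walk of length `2^i ℓ` from `s` ends at `u` and is in `S` at step `j ℓ` for every
`1 ≤ j ≤ 2^i`. -/
noncomputable def returnProb (G : SimpleGraph V) [DecidableRel G.Adj] (d ℓ : ℕ) (S : Finset V)
    (i : ℕ) (s u : V) : ℝ :=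
  walkProb G d (2 ^ i * ℓ) s (fun w => w (Fin.last (2 ^ i * ℓ)) = u ∧
    ∀ j ∈ Finset.Icc 1 (2 ^ i), ∀ k : Fin (2 ^ i * ℓ + 1), (k : ℕ) = j * ℓ → w k ∈ S)

/-- The squared Euclidean norm of the vector of `S`-returning probabilities from `s`, indexed
by `u ∈ S`. -/
noncomputable def returnNormSq (G : SimpleGraph V) [DecidableRel G.Adj] (d ℓ : ℕ) (S : Finset V)
    (i : ℕ) (s : V) : ℝ :=
  ∑ u ∈ S, returnProb G d ℓ S i s u ^ 2

end LocalPartition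

/-!
The set `P` is found by watching the walk only at its visits to `S`. Two visits are joined by an
excursion outside `S`, and the resulting transition matrix on `S` is symmetric because the walk is.
Restricting to excursions of length at most `T` (`returnKernel`) keeps the matrix symmetric, makes
it substochastic, and leaves everything finite. It dominates the one-step transition probabilities
inside `S`, so an edge cut of `S` bounds the cut in the watched walk from below. Write `N = n ^ δ`
and let `T` be about `160 N ^ (i + 7) / α`.

Fix `s` and suppose that no `P` works for it. Let `Z` be the set of `v ∈ S` that are reached within
`T` steps with the required probability. Then every nonempty subset of `Z` has a large boundary in
`S`, while for every `k` the `k`-th visit takes place within `T` steps and at a given vertex of `S`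
off `Z` with probability at most `θ = N ^ (-i - 6)`. The Lovász–Simonovits curve argument bounds the
mass of the `k`-th visit on a fractional set of size `x` by `√x * (1 - φ ^ 2 / 2) ^ k + θ * x`,
where `φ = n ^ (-δ / 4)` (`SpreadBound.step`, `spreadBound_visitWithin`). The hypothesis covers all
subsets of `Z`, not only level sets, so convexity reduces the induction to indicator functions and
no ordering of the vertices is needed.

Let `K = ⌊N⌋`. A finite form of Kac's formula (`mul_sum_fewVisits_le`) shows that from at least half
of `S'` the walk visits `S` fewer than `K` times in `ℓ` steps with probability at most `1 / (4 N)`.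
For such an `s` the spread bound is contradicted (`exists_sparse_of_concentrated`). If `N ^ (i + 4)
< n`, then `2 ^ i` is much smaller than `N`. Walks with fewer than `K` visits contribute little to
the squared norm of the return vector at level `i + 1`, as its entries are at most `N ^ (1 - i)` by
the Cauchy–Schwarz inequality (`returnProb_succ_le`). In a walk with at least `K` visits, the end is
one of at most `2 ^ (i + 1) * ℓ` visits, each of which is spread out. Together they stay below `N ^
(-i)`. If `N ^ (i + 4) ≥ n`, the `K`-th visit happens within `T` steps with probability at least `1
- 1 / (4 N)`, whereas the spread bound, applied to the whole vertex set, allows at most `1 / 2`.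
-/

namespace LocalPartition

/-! ### Words with a prescribed number of letters -/

section Words

variable {R : Type*} [Semiring R]

/-- The sum of all words of length `t` in the letters `a`, `b` with exactly `k` letters `a`. -/
def wordSum (a b : R) : ℕ → ℕ → R
  | 0, 0 => 1
  | 0, _ + 1 => 0
  | t + 1, 0 => wordSum a b t 0 * b
  | t + 1, k + 1 => wordSum a b t k * a + wordSum a b t (k + 1) * b

theorem wordSum_succ_zero (a b : R) (t : ℕ) :
    wordSum a b (t + 1) 0 = wordSum a b t 0 * b := rfl

theorem wordSum_succ_succ (a b : R) (t k : ℕ) :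
    wordSum a b (t + 1) (k + 1) = wordSum a b t k * a + wordSum a b t (k + 1) * b := rfl

theorem wordSum_succ_left (a b : R) (t : ℕ) :
    wordSum a b (t + 1) 0 = b * wordSum a b t 0 ∧
      ∀ k, wordSum a b (t + 1) (k + 1) = a * wordSum a b t k + b * wordSum a b t (k + 1) := by
  induction t with
  | zero =>
    refine ⟨by simp [wordSum], fun k => ?_⟩
    cases k <;> simp [wordSum]
  | succ t ih =>
    refine ⟨?_, fun k => ?_⟩
    · rw [wordSum_succ_zero, ih.1, mul_assoc, ← wordSum_succ_zero, ih.1]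
    · rw [wordSum_succ_succ a b (t + 1) k]
      conv_lhs => rw [ih.2 k]
      conv_rhs => rw [wordSum_succ_succ a b t k]
      cases k with
      | zero =>
        conv_lhs => rw [ih.1]
        conv_rhs => rw [wordSum_succ_zero]
        simp only [add_mul, mul_add, mul_assoc]
        abel
      | succ k =>
        conv_lhs => rw [ih.2 k]
        conv_rhs => rw [wordSum_succ_succ a b t k]
        simp only [add_mul, mul_add, mul_assoc]
        abel

theorem wordSum_eq_zero (a b : R) {t k : ℕ} (h : t < k) : wordSum a b t k = 0 := by
  induction t generalizing k with
  | zero =>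
    obtain ⟨k, rfl⟩ := Nat.exists_eq_succ_of_ne_zero h.ne'
    rfl
  | succ t ih =>
    obtain ⟨k, rfl⟩ := Nat.exists_eq_succ_of_ne_zero (by omega : k ≠ 0)
    rw [wordSum, ih (by omega), ih (by omega)]
    simp

theorem sum_wordSum_succ (a b : R) (t m : ℕ) :
    ∑ k ∈ Finset.range (m + 1), wordSum a b (t + 1) k =
      (∑ k ∈ Finset.range m, wordSum a b t k) * a
        + (∑ k ∈ Finset.range (m + 1), wordSum a b t k) * b := by
  rw [Finset.sum_range_succ', Finset.sum_range_succ' (fun k => wordSum a b t k)]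
  simp only [wordSum, Finset.sum_add_distrib, Finset.sum_mul, add_mul]
  abel

theorem sum_wordSum_succ_left (a b : R) (t m : ℕ) :
    ∑ k ∈ Finset.range (m + 1), wordSum a b (t + 1) k =
      a * (∑ k ∈ Finset.range m, wordSum a b t k)
        + b * (∑ k ∈ Finset.range (m + 1), wordSum a b t k) := by
  rw [Finset.sum_range_succ', Finset.sum_range_succ' (fun k => wordSum a b t k)]
  simp only [(wordSum_succ_left a b t).1, (wordSum_succ_left a b t).2, Finset.sum_add_distrib,
    Finset.mul_sum, mul_add]
  abel

theorem sum_wordSum (a b : R) (t : ℕ) :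
    ∑ k ∈ Finset.range (t + 1), wordSum a b t k = (a + b) ^ t := by
  induction t with
  | zero => simp [wordSum]
  | succ t ih =>
    rw [sum_wordSum_succ, Finset.sum_range_succ _ (t + 1), wordSum_eq_zero a b (Nat.lt_succ_self t),
      add_zero, ih, pow_succ, mul_add]

/-- Cutting each word after its last letter `a`: if `p` is an idempotent with `a * p = a` and
`b * p = 0`, then `wordSum a b m k * p` keeps the words that end with an `a` (or are empty), and
what follows is a power of `b`. -/
theorem mul_wordSum_eq_sum {a b p : R} (hp : p * p = p) (ha : a * p = a) (hb : b * p = 0)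
    (t k : ℕ) :
    p * wordSum a b t k =
      ∑ j ∈ Finset.range (t + 1), p * wordSum a b (t - j) k * p * b ^ j := by
  induction t with
  | zero =>
    cases k with
    | zero => simp [wordSum, hp]
    | succ k => simp [wordSum]
  | succ t ih =>
    rw [Finset.sum_range_succ']
    have h : ∀ j ∈ Finset.range (t + 1),
        p * wordSum a b (t + 1 - (j + 1)) k * p * b ^ (j + 1)
          = p * wordSum a b (t - j) k * p * b ^ j * b := by
      intro j _
      rw [Nat.add_sub_add_right, pow_succ, mul_assoc _ (b ^ j) b]
    rw [Finset.sum_congr rfl h, ← Finset.sum_mul, ← ih]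
    cases k with
    | zero => simp [wordSum, mul_assoc, hb]
    | succ k => simp [wordSum, mul_assoc, add_mul, mul_add, ha, hb, add_comm]

end Words

/-! ### Entrywise nonnegative matrices -/

section Nonneg

variable {V : Type*} [Fintype V]

theorem mul_entries_nonneg {A B : Matrix V V ℝ} (hA : ∀ u v, 0 ≤ A u v) (hB : ∀ u v, 0 ≤ B u v)
    (u v : V) : 0 ≤ (A * B) u v := by
  rw [Matrix.mul_apply]
  exact Finset.sum_nonneg fun x _ => mul_nonneg (hA u x) (hB x v)

variable [DecidableEq V]

theorem pow_entries_nonneg {A : Matrix V V ℝ} (hA : ∀ u v, 0 ≤ A u v) (m : ℕ) (u v : V) :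
    0 ≤ (A ^ m) u v := by
  induction m generalizing u v with
  | zero => rw [pow_zero, Matrix.one_apply]; split_ifs <;> norm_num
  | succ m ih => rw [pow_succ]; exact mul_entries_nonneg ih hA u v

theorem wordSum_entries_nonneg {A B : Matrix V V ℝ} (hA : ∀ u v, 0 ≤ A u v)
    (hB : ∀ u v, 0 ≤ B u v) (t k : ℕ) (u v : V) : 0 ≤ wordSum A B t k u v := by
  induction t generalizing k u v with
  | zero =>
    cases k with
    | zero => rw [wordSum, Matrix.one_apply]; split_ifs <;> norm_num
    | succ k => simp [wordSum]
  | succ t ih =>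
    cases k with
    | zero => rw [wordSum]; exact mul_entries_nonneg (ih 0) hB u v
    | succ k =>
      rw [wordSum, Matrix.add_apply]
      exact add_nonneg (mul_entries_nonneg (ih k) hA u v) (mul_entries_nonneg (ih (k + 1)) hB u v)

end Nonneg

/-! ### Coordinate projections -/

section Projection

variable {V : Type*} [DecidableEq V]

/-- The coordinate projection onto `S`. -/
def proj (S : Finset V) : Matrix V V ℝ := Matrix.diagonal fun v => if v ∈ S then 1 else 0

theorem proj_entries_nonneg (S : Finset V) (u v : V) : 0 ≤ proj S u v := by
  rw [proj, Matrix.diagonal_apply]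
  split_ifs <;> norm_num

theorem proj_transpose (S : Finset V) : (proj S).transpose = proj S := by
  rw [proj, Matrix.diagonal_transpose]

variable [Fintype V]

theorem mul_proj_apply (A : Matrix V V ℝ) (S : Finset V) (u v : V) :
    (A * proj S) u v = if v ∈ S then A u v else 0 := by
  simp [proj, Matrix.mul_diagonal]

theorem proj_mul_apply (A : Matrix V V ℝ) (S : Finset V) (u v : V) :
    (proj S * A) u v = if u ∈ S then A u v else 0 := by
  simp [proj, Matrix.diagonal_mul]

theorem proj_mul_proj (S : Finset V) : proj S * proj S = proj S := by
  ext u v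
  rw [mul_proj_apply, proj, Matrix.diagonal_apply]
  split_ifs <;> simp_all

theorem proj_compl_mul_proj (S : Finset V) : proj Sᶜ * proj S = 0 := by
  ext u v
  rw [mul_proj_apply, proj, Matrix.diagonal_apply]
  split_ifs <;> simp_all

theorem proj_add_proj_compl (S : Finset V) : proj S + proj Sᶜ = 1 := by
  ext u v
  rw [Matrix.add_apply, proj, proj, Matrix.diagonal_apply, Matrix.diagonal_apply, Matrix.one_apply]
  split_ifs <;> simp_all

end Projection

/-! ### Trajectories and powers of the transition matrix -/

section Trajectories

variable {V : Type*} [Fintype V] [DecidableEq V]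

/-- The transition matrix of the lazy walk. -/
noncomputable def walkMatrix (G : SimpleGraph V) [DecidableRel G.Adj] (d : ℕ) : Matrix V V ℝ :=
  Matrix.of fun u v => stepProb G d u v

/-- Multiplying `t` transition matrices, with the projection onto `A k` inserted after the `k`-th
step. -/
noncomputable def constrainedPow (M : Matrix V V ℝ) (A : ℕ → Finset V) : ℕ → Matrix V V ℝ
  | 0 => 1
  | t + 1 => constrainedPow M A t * M * proj (A (t + 1))

theorem trajectoryProb_snoc (G : SimpleGraph V) [DecidableRel G.Adj] (d t : ℕ)
    (w : Fin (t + 1) → V) (x : V) :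
    trajectoryProb G d (t := t + 1) (Fin.snoc (α := fun _ => V) w x) =
      trajectoryProb G d w * stepProb G d (w (Fin.last t)) x := by
  unfold trajectoryProb
  rw [Fin.prod_univ_castSucc]
  congr 1
  · refine Finset.prod_congr rfl fun k _ => ?_
    rw [Fin.snoc_castSucc (α := fun _ => V), ← Fin.castSucc_succ,
      Fin.snoc_castSucc (α := fun _ => V)]
  · rw [Fin.succ_last, Fin.snoc_last, Fin.snoc_castSucc (α := fun _ => V)]

theorem walkProb_eq_constrainedPow (G : SimpleGraph V) [DecidableRel G.Adj] (d : ℕ)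
    (A : ℕ → Finset V) (t : ℕ) (s v : V) :
    walkProb G d t s (fun w => w (Fin.last t) = v ∧ ∀ k : Fin t, w k.succ ∈ A (k + 1)) =
      constrainedPow (walkMatrix G d) A t s v := by
  classical
  induction t generalizing v with
  | zero =>
    unfold walkProb
    rw [constrainedPow, Matrix.one_apply, Finset.sum_filter,
      ← (Equiv.funUnique (Fin 1) V).symm.sum_comp]
    simp [trajectoryProb, ite_and]
  | succ t ih =>
    have h : ∀ u, (constrainedPow (walkMatrix G d) A t) s u * walkMatrix G d u v =
        ∑ w : Fin (t + 1) → V, if w (Fin.last t) = u then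
          if w 0 = s ∧ ∀ k : Fin t, w k.succ ∈ A (k + 1) then
            trajectoryProb G d w * stepProb G d (w (Fin.last t)) v else 0 else 0 := by
      intro u
      rw [← ih u, walkProb, Finset.sum_filter, Finset.sum_mul]
      refine Finset.sum_congr rfl fun w _ => ?_
      by_cases hu : w (Fin.last t) = u
      · simp [hu, walkMatrix]
      · simp [hu]
    rw [constrainedPow, mul_proj_apply, Matrix.mul_apply, Finset.sum_congr rfl fun u _ => h u,
      Finset.sum_comm]
    unfold walkProb
    rw [Finset.sum_filter, ← (Fin.snocEquiv fun _ : Fin (t + 2) => V).sum_comp,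
      Fintype.sum_prod_type, Finset.sum_comm]
    simp only [Fin.snocEquiv_apply, Fin.snoc_last, Fin.forall_fin_succ',
      Fin.succ_last, ← Fin.castSucc_succ, Fin.snoc_castSucc, Fin.val_last, Fin.val_castSucc]
    have h0 : ∀ (w : Fin (t + 1) → V) (x : V),
        (Fin.snoc (α := fun _ => V) w x : Fin (t + 2) → V) 0 = w 0 := fun w x => by
      rw [← Fin.castSucc_zero, Fin.snoc_castSucc (α := fun _ => V)]
    have h1 : ∀ (w : Fin (t + 1) → V) (x : V),
        trajectoryProb G d ((Fin.snocEquiv fun _ : Fin (t + 2) => V) (x, w)) =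
          trajectoryProb G d w * stepProb G d (w (Fin.last t)) x := fun w x =>
      trajectoryProb_snoc G d t w x
    simp only [h0, h1]
    by_cases hv : v ∈ A (t + 1)
    · rw [if_pos hv]
      refine Finset.sum_congr rfl fun w _ => ?_
      rw [Finset.sum_ite_eq Finset.univ (w (Fin.last t)), if_pos (Finset.mem_univ _),
        Finset.sum_eq_single v]
      · simp [hv]
      · intro x _ hx
        simp [hx]
      · simp
    · rw [if_neg hv]
      refine Finset.sum_eq_zero fun w _ => Finset.sum_eq_zero fun x _ => if_neg ?_
      rintro ⟨-, rfl, -, hx⟩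
      exact hv hx

theorem reachProb_eq_pow (G : SimpleGraph V) [DecidableRel G.Adj] (d t : ℕ) (s v : V) :
    reachProb G d t s v = (walkMatrix G d ^ t) s v := by
  have h : ∀ t, constrainedPow (walkMatrix G d) (fun _ => Finset.univ) t = walkMatrix G d ^ t := by
    intro t
    induction t with
    | zero => rfl
    | succ t ih =>
      have h1 : proj (Finset.univ : Finset V) = 1 := by simp [proj]
      rw [constrainedPow, ih, h1, mul_one, pow_succ]
  rw [← h, ← walkProb_eq_constrainedPow]
  simp [reachProb]

/-- Returning walks are those constrained to lie in `S` at the positive multiples of `ℓ`. -/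
theorem returnProb_eq_pow (G : SimpleGraph V) [DecidableRel G.Adj] (d : ℕ) {ℓ : ℕ} (hℓ : 0 < ℓ)
    (S : Finset V) (i : ℕ) (s u : V) :
    returnProb G d ℓ S i s u = ((walkMatrix G d ^ ℓ * proj S) ^ 2 ^ i) s u := by
  set A : ℕ → Finset V := fun k => if ℓ ∣ k then S else Finset.univ with hA
  have hr : ∀ j, constrainedPow (walkMatrix G d) A (j * ℓ) =
      (walkMatrix G d ^ ℓ * proj S) ^ j → ∀ r, r < ℓ →
      constrainedPow (walkMatrix G d) A (j * ℓ + r) =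
        (walkMatrix G d ^ ℓ * proj S) ^ j * walkMatrix G d ^ r := by
    intro j hj r
    induction r with
    | zero => intro _; simpa using hj
    | succ r ih =>
      intro hlt
      have hnd : ¬ ℓ ∣ j * ℓ + r + 1 := by
        rw [add_assoc, Nat.dvd_add_right (Dvd.intro_left j rfl)]
        exact Nat.not_dvd_of_pos_of_lt (Nat.succ_pos r) hlt
      have h1 : proj (Finset.univ : Finset V) = 1 := by simp [proj]
      rw [← add_assoc, constrainedPow, ih (by omega), hA]
      simp only [hnd, if_false]
      rw [h1, mul_one, mul_assoc, ← pow_succ]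
  have hs : ∀ j, constrainedPow (walkMatrix G d) A (j * ℓ) =
      (walkMatrix G d ^ ℓ * proj S) ^ j := by
    intro j
    induction j with
    | zero => simp [constrainedPow]
    | succ j ih =>
      have he : (j + 1) * ℓ = j * ℓ + (ℓ - 1) + 1 := by
        rw [add_assoc, Nat.sub_add_cancel hℓ]; ring
      have hd : ℓ ∣ j * ℓ + (ℓ - 1) + 1 := he ▸ Dvd.intro_left (j + 1) rfl
      rw [he, constrainedPow, hr j ih (ℓ - 1) (by omega), hA]
      simp only [hd, if_true]
      rw [mul_assoc (_ ^ j), ← pow_succ, Nat.sub_add_cancel hℓ, mul_assoc, ← pow_succ]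
  rw [← hs (2 ^ i), ← walkProb_eq_constrainedPow, returnProb]
  congr 1
  ext w
  refine and_congr_right fun _ => ⟨fun h k => ?_, fun h j hj k hk => ?_⟩
  · simp only [hA]
    split_ifs with hd
    · obtain ⟨j, hj⟩ := hd
      have hk : (k : ℕ) + 1 ≤ 2 ^ i * ℓ := k.2
      refine h j (Finset.mem_Icc.2 ⟨?_, ?_⟩) k.succ (by rw [Fin.val_succ, hj, mul_comm])
      · rcases Nat.eq_zero_or_pos j with rfl | hj0
        · simp at hj
        · exact hj0
      · rw [hj, mul_comm] at hk
        exact Nat.le_of_mul_le_mul_right hk hℓ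
    · exact Finset.mem_univ _
  · have hk0 : k ≠ 0 := by
      rintro rfl
      have : 0 < j * ℓ := Nat.mul_pos (Finset.mem_Icc.1 hj).1 hℓ
      rw [← hk] at this
      simp at this
    obtain ⟨k', rfl⟩ := Fin.exists_succ_eq.2 hk0
    have := h k'
    rw [Fin.val_succ] at hk
    simpa only [hA, hk, Dvd.intro_left j rfl, if_true] using this

end Trajectories

/-! ### The curve argument for symmetric substochastic matrices -/

section Spread

variable {V : Type*} [Fintype V]

/-- The weight that `τ` gives to a fractional set `c : V → [0, 1]` of total size `x` is at most
`ρ * √x + θ * x`. -/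
def SpreadBound (τ : V → ℝ) (ρ θ : ℝ) : Prop :=
  ∀ c : V → ℝ, (∀ v, 0 ≤ c v) → (∀ v, c v ≤ 1) →
    ∑ v, c v * τ v ≤ ρ * √(∑ v, c v) + θ * ∑ v, c v

/-- Subsets suffice: `∑ c τ - ρ √(∑ c) - θ ∑ c` is convex in `c`, so it is largest at a vertex of
the cube `[0, 1]^V`. -/
theorem SpreadBound.of_finset {τ : V → ℝ} {ρ θ : ℝ} (hρ : 0 ≤ ρ)
    (h : ∀ Y : Finset V, ∑ v ∈ Y, τ v ≤ ρ * √(Y.card : ℝ) + θ * Y.card) :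
    SpreadBound τ ρ θ := by
  classical
  intro c hc0 hc1
  set F : (V → ℝ) → ℝ := fun c => ∑ v, c v * τ v - θ * ∑ v, c v - ρ * √(∑ v, c v) with hF
  have hlin : ∀ (x y : V → ℝ) (p q : ℝ) (g : V → ℝ),
      ∑ v, (p • x + q • y) v * g v = p * ∑ v, x v * g v + q * ∑ v, y v * g v := by
    intro x y p q g
    rw [Finset.mul_sum, Finset.mul_sum, ← Finset.sum_add_distrib]
    refine Finset.sum_congr rfl fun v _ => ?_
    simp only [Pi.add_apply, Pi.smul_apply, smul_eq_mul]
    ring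
  have hlin1 : ∀ (x y : V → ℝ) (p q : ℝ),
      ∑ v, (p • x + q • y) v = p * ∑ v, x v + q * ∑ v, y v := by
    intro x y p q
    simpa using hlin x y p q fun _ => 1
  have hcube : Convex ℝ {x : V → ℝ | ∀ v, 0 ≤ x v} := by
    intro x hx y hy p q hp hq _ v
    exact add_nonneg (mul_nonneg hp (hx v)) (mul_nonneg hq (hy v))
  have hpos : ∀ x ∈ {x : V → ℝ | ∀ v, 0 ≤ x v}, 0 ≤ ∑ v, x v := fun x hx =>
    Finset.sum_nonneg fun v _ => hx v
  have hconv : ConvexOn ℝ {x : V → ℝ | ∀ v, 0 ≤ x v} F := by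
    refine ⟨hcube, fun x hx y hy p q hp hq hpq => ?_⟩
    have hs := Real.strictConcaveOn_sqrt.concaveOn.2
      (Set.mem_Ici.2 (hpos x hx))
      (Set.mem_Ici.2 (hpos y hy)) hp hq hpq
    simp only [hF, smul_eq_mul] at hs ⊢
    rw [hlin, hlin1]
    nlinarith [mul_le_mul_of_nonneg_left hs hρ]
  have hmem : c ∈ convexHull ℝ (Set.univ.pi fun _ : V => ({0, 1} : Set ℝ)) := by
    rw [convexHull_pi]
    intro v _
    rw [convexHull_pair, segment_eq_Icc zero_le_one]
    exact ⟨hc0 v, hc1 v⟩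
  obtain ⟨y, hy, hle⟩ := hconv.exists_ge_of_mem_convexHull (by
    intro y hy v
    rcases hy v (Set.mem_univ v) with h0 | h0 <;> rw [h0]
    exact zero_le_one) hmem
  have hyv : ∀ v, y v = if v ∈ Finset.univ.filter (fun v => y v = 1) then 1 else 0 := by
    intro v
    rcases hy v (Set.mem_univ v) with h0 | h0
    · simp [h0]
    · simp [Set.mem_singleton_iff.1 h0]
  have hFy : F y ≤ 0 := by
    have hY := h (Finset.univ.filter fun v => y v = 1)
    have h1 : ∑ v, y v * τ v = ∑ v ∈ Finset.univ.filter (fun v => y v = 1), τ v := by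
      rw [Finset.sum_congr rfl fun v _ => by rw [hyv v], Finset.sum_filter]
      refine Finset.sum_congr rfl fun v _ => by simp
    have h2 : ∑ v, y v = ((Finset.univ.filter fun v => y v = 1).card : ℝ) := by
      rw [Finset.sum_congr rfl fun v _ => by rw [hyv v], Finset.card_filter]
      simp
    simp only [hF, h1, h2]
    linarith
  simp only [hF] at hle hFy
  linarith

theorem SpreadBound.apply_le {τ : V → ℝ} {ρ θ : ℝ} (h : SpreadBound τ ρ θ) (v : V) :
    τ v ≤ ρ + θ := by
  classical
  have := h (fun u => if u = v then 1 else 0) (fun u => by split_ifs <;> norm_num)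
    (fun u => by split_ifs <;> norm_num)
  simpa using this

theorem SpreadBound.sum_le {τ : V → ℝ} {ρ θ : ℝ} (h : SpreadBound τ ρ θ) :
    ∑ v, τ v ≤ ρ * √(Fintype.card V) + θ * Fintype.card V := by
  simpa using h (fun _ => 1) (fun _ => zero_le_one) (fun _ => le_rfl)

theorem spreadBound_single [DecidableEq V] (s : V) {θ : ℝ} (hθ : 0 ≤ θ) :
    SpreadBound (fun v => if s = v then 1 else 0) 1 θ := by
  intro c hc0 hc1
  have h1 : c s ≤ √(∑ v, c v) := by
    refine Real.le_sqrt_of_sq_le ?_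
    have := Finset.single_le_sum (fun v _ => hc0 v) (Finset.mem_univ s)
    nlinarith [hc0 s, hc1 s]
  have h2 : 0 ≤ θ * ∑ v, c v := mul_nonneg hθ (Finset.sum_nonneg fun v _ => hc0 v)
  simp only [mul_ite, mul_one, mul_zero, Finset.sum_ite_eq, Finset.mem_univ, if_true]
  linarith

theorem sqrt_sub_add_sqrt_add_le {x y φ : ℝ} (hφ : 0 ≤ φ) (hφx : φ * x ≤ y) (hyx : y ≤ x)
    (hy : 0 ≤ y) : √(x - y) + √(x + y) ≤ 2 * (1 - φ ^ 2 / 8) * √x := by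
  have hx : 0 ≤ x := hy.trans hyx
  rcases hx.eq_or_lt with rfl | hx0
  · have : y = 0 := le_antisymm hyx hy
    simp [this]
  have hφ1 : φ ≤ 1 := by
    by_contra hcon
    nlinarith
  have h1 : √(x - y) * √(x + y) ≤ x * (1 - φ ^ 2 / 2) := by
    rw [← Real.sqrt_mul (by linarith)]
    refine Real.sqrt_le_iff.2 ⟨mul_nonneg hx (by nlinarith), ?_⟩
    have : (φ * x) ^ 2 ≤ y ^ 2 := pow_le_pow_left₀ (mul_nonneg hφ hx) hφx 2
    nlinarith [sq_nonneg (x * φ ^ 2)]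
  refine (sq_le_sq₀ (by positivity) (mul_nonneg (by nlinarith) (Real.sqrt_nonneg x))).1 ?_
  have e1 := Real.sq_sqrt (by linarith : 0 ≤ x - y)
  have e2 := Real.sq_sqrt (by linarith : 0 ≤ x + y)
  have e3 := Real.sq_sqrt hx
  rw [mul_pow, e3]
  nlinarith [mul_nonneg hx (sq_nonneg (φ ^ 2))]

/-- The heart of the curve argument: the set `X` receives from `u` the fraction `∑ v ∈ X, P u v`,
which laziness allows to write as the mean of two fractional sets of sizes `|X| - y` and `|X| + y`,
where `y` is twice the weight of the cut around `X`. -/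
theorem sum_sum_mul_le_of_cut [DecidableEq V] {P : V → V → ℝ} (hP0 : ∀ u v, 0 ≤ P u v)
    (hPs : ∀ u v, P u v = P v u) (hP1 : ∀ u, ∑ v, P u v ≤ 1) {X : Finset V}
    (hin : ∀ u ∈ X, 1 / 2 ≤ P u u) (hout : ∀ u ∉ X, ∑ v ∈ X, P u v ≤ 1 / 2)
    {φ : ℝ} (hφ : 0 ≤ φ) (hcut : φ * X.card ≤ ∑ u ∈ X, ∑ v ∈ Xᶜ, P u v)
    {τ : V → ℝ} {ρ θ : ℝ} (hρ : 0 ≤ ρ) (hθ : 0 ≤ θ) (h : SpreadBound τ ρ θ) :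
    ∑ v ∈ X, ∑ u, τ u * P u v ≤
      ρ * (1 - φ ^ 2 / 2) * √(X.card : ℝ) + θ * X.card := by
  set c : V → ℝ := fun u => ∑ v ∈ X, P u v with hc
  set C : ℝ := ∑ u ∈ X, ∑ v ∈ Xᶜ, P u v with hC
  have hc0 : ∀ u, 0 ≤ c u := fun u => Finset.sum_nonneg fun v _ => hP0 u v
  have hrow : ∀ u, c u + ∑ v ∈ Xᶜ, P u v ≤ 1 := fun u => by
    rw [hc, Finset.sum_add_sum_compl]
    exact hP1 u
  have hc1 : ∀ u, c u ≤ 1 := fun u => by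
    have := hrow u
    have := Finset.sum_nonneg fun v (_ : v ∈ Xᶜ) => hP0 u v
    linarith
  have hcin : ∀ u ∈ X, 1 / 2 ≤ c u := fun u hu =>
    (hin u hu).trans (Finset.single_le_sum (fun v _ => hP0 u v) hu)
  have hsplit : ∀ f : V → ℝ, ∑ u, f u = ∑ u ∈ X, f u + ∑ u ∈ Xᶜ, f u := fun f =>
    (Finset.sum_add_sum_compl X f).symm
  have hC0 : 0 ≤ C := Finset.sum_nonneg fun u _ => Finset.sum_nonneg fun v _ => hP0 u v
  have hCc : C = ∑ u ∈ Xᶜ, c u := by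
    rw [hC, Finset.sum_comm]
    exact Finset.sum_congr rfl fun v _ => Finset.sum_congr rfl fun u _ => hPs u v
  have hCX : ∑ u ∈ X, c u ≤ X.card - C := by
    have : ∑ u ∈ X, (c u + ∑ v ∈ Xᶜ, P u v) ≤ ∑ u ∈ X, (1 : ℝ) :=
      Finset.sum_le_sum fun u _ => hrow u
    rw [Finset.sum_add_distrib, Finset.sum_const, nsmul_eq_mul, mul_one] at this
    linarith
  -- The two fractional sets, whose mean is `c`.
  set c₁ : V → ℝ := fun u => if u ∈ X then 2 * c u - 1 else 0 with hc₁
  set c₂ : V → ℝ := fun u => if u ∈ X then 1 else 2 * c u with hc₂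
  have s₁ : ∑ u, c₁ u ≤ X.card - 2 * C := by
    rw [hsplit, Finset.sum_congr rfl fun u hu => if_pos hu,
      Finset.sum_congr (s₁ := Xᶜ) rfl fun u hu => if_neg (Finset.mem_compl.1 hu),
      Finset.sum_const_zero, Finset.sum_sub_distrib, ← Finset.mul_sum, Finset.sum_const,
      nsmul_eq_mul]
    linarith
  have s₂ : ∑ u, c₂ u = X.card + 2 * C := by
    rw [hsplit, Finset.sum_congr rfl fun u hu => if_pos hu,
      Finset.sum_congr (s₁ := Xᶜ) rfl fun u hu => if_neg (Finset.mem_compl.1 hu),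
      ← Finset.mul_sum, Finset.sum_const, nsmul_eq_mul, hCc]
    ring
  have n₁ : ∀ u, 0 ≤ c₁ u := fun u => by
    simp only [hc₁]
    split_ifs with hu
    · linarith [hcin u hu]
    · exact le_rfl
  have b₁ := h c₁ n₁ (fun u => by
    simp only [hc₁]
    split_ifs
    · linarith [hc1 u]
    · exact zero_le_one)
  have b₂ := h c₂ (fun u => by
    simp only [hc₂]
    split_ifs
    · exact zero_le_one
    · linarith [hc0 u]) (fun u => by
    simp only [hc₂]
    split_ifs with hu
    · exact le_rfl
    · linarith [hout u hu])
  have hmean : ∑ v ∈ X, ∑ u, τ u * P u v = (∑ u, c₁ u * τ u + ∑ u, c₂ u * τ u) / 2 := by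
    rw [Finset.sum_comm, ← Finset.sum_add_distrib, Finset.sum_div]
    refine Finset.sum_congr rfl fun u _ => ?_
    rw [← Finset.mul_sum]
    change τ u * c u = _
    simp only [hc₁, hc₂]
    split_ifs <;> ring
  have h2C : 2 * C ≤ X.card := by
    have := Finset.sum_nonneg fun u (_ : u ∈ Finset.univ) => n₁ u
    linarith
  have hsq := sqrt_sub_add_sqrt_add_le (φ := 2 * φ) (by positivity)
    (by linarith : 2 * φ * (X.card : ℝ) ≤ 2 * C) h2C (by positivity)
  have m₁ := mul_le_mul_of_nonneg_left (Real.sqrt_le_sqrt s₁) hρ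
  have m₂ := mul_le_mul_of_nonneg_left s₁ hθ
  have m₃ := mul_le_mul_of_nonneg_left hsq hρ
  rw [s₂] at b₂
  rw [hmean]
  linarith

/-- One step of a symmetric substochastic matrix improves a spread bound, provided that every
nonempty subset of `Z` has large boundary and that little mass sits at each point off `Z`. -/
theorem SpreadBound.step [DecidableEq V] {P : V → V → ℝ} (hP0 : ∀ u v, 0 ≤ P u v)
    (hPs : ∀ u v, P u v = P v u) (hP1 : ∀ u, ∑ v, P u v ≤ 1) {Z : Finset V}
    (hin : ∀ u ∈ Z, 1 / 2 ≤ P u u) (hout : ∀ X ⊆ Z, ∀ u ∉ X, ∑ v ∈ X, P u v ≤ 1 / 2)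
    {φ : ℝ} (hφ : 0 ≤ φ) (hφ1 : φ ≤ 1)
    (hcut : ∀ X ⊆ Z, X.Nonempty → φ * X.card ≤ ∑ u ∈ X, ∑ v ∈ Xᶜ, P u v)
    {τ τ' : V → ℝ} {ρ θ : ℝ} (hρ : 0 ≤ ρ) (hθ : 0 ≤ θ) (h : SpreadBound τ ρ θ)
    (hτ : ∀ v, τ' v ≤ ∑ u, τ u * P u v) (hZ : ∀ v ∉ Z, τ' v ≤ θ) :
    SpreadBound τ' (ρ * (1 - φ ^ 2 / 2)) θ := by
  have hρ' : 0 ≤ ρ * (1 - φ ^ 2 / 2) := mul_nonneg hρ (by nlinarith)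
  refine SpreadBound.of_finset hρ' fun Y => ?_
  have hX : ∑ v ∈ Y ∩ Z, τ' v ≤ ρ * (1 - φ ^ 2 / 2) * √((Y ∩ Z).card : ℝ)
      + θ * (Y ∩ Z).card := by
    rcases (Y ∩ Z).eq_empty_or_nonempty with he | hne
    · simp [he]
    · have hsub : Y ∩ Z ⊆ Z := Finset.inter_subset_right
      exact (Finset.sum_le_sum fun v _ => hτ v).trans
        (sum_sum_mul_le_of_cut hP0 hPs hP1 (fun u hu => hin u (hsub hu)) (hout _ hsub) hφ
          (hcut _ hsub hne) hρ hθ h)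
  have hrest : ∑ v ∈ Y \ Z, τ' v ≤ θ * (Y \ Z).card := by
    have := Finset.sum_le_sum fun v (hv : v ∈ Y \ Z) => hZ v (Finset.mem_sdiff.1 hv).2
    rwa [Finset.sum_const, nsmul_eq_mul, mul_comm] at this
  have hcard : ((Y ∩ Z).card : ℝ) + (Y \ Z).card = Y.card := by
    exact_mod_cast Finset.card_inter_add_card_sdiff Y Z
  have hsum : ∑ v ∈ Y, τ' v = ∑ v ∈ Y ∩ Z, τ' v + ∑ v ∈ Y \ Z, τ' v :=
    (Finset.sum_inter_add_sum_sdiff Y Z τ').symm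
  have hsq : √((Y ∩ Z).card : ℝ) ≤ √(Y.card : ℝ) :=
    Real.sqrt_le_sqrt (by rw [← hcard]; exact le_add_of_nonneg_right (Nat.cast_nonneg _))
  have := mul_le_mul_of_nonneg_left hsq hρ'
  rw [hsum, ← hcard]
  rw [← hcard] at this
  linarith

end Spread

/-! ### Counting visits to a set -/

section Visits

open Matrix

variable {V : Type*} [Fintype V]

theorem mulVec_one_apply (A : Matrix V V ℝ) (u : V) : (A *ᵥ 1) u = ∑ v, A u v := by
  simp [Matrix.mulVec, dotProduct]

variable [DecidableEq V]

/-- Entry `(u, v)` is the probability that `t` steps from `u` lead to `v` and exactly `k` of the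
times `1, …, t` are spent in `S`. -/
def visitMatrix (M : Matrix V V ℝ) (S : Finset V) (t k : ℕ) : Matrix V V ℝ :=
  wordSum (M * proj S) (M * proj Sᶜ) t k

/-- The probability that fewer than `K` of the times `1, …, t` are spent in `S`, as a function of
the starting point. -/
def fewVisits (M : Matrix V V ℝ) (S : Finset V) (K t : ℕ) : V → ℝ :=
  (∑ k ∈ Finset.range K, visitMatrix M S t k) *ᵥ 1

variable {M : Matrix V V ℝ} (S : Finset V)

theorem mul_proj_add_mul_proj_compl : M * proj S + M * proj Sᶜ = M := by
  rw [← mul_add, proj_add_proj_compl, mul_one]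

theorem visitMatrix_nonneg (hM0 : ∀ u v, 0 ≤ M u v) (t k : ℕ) (u v : V) :
    0 ≤ visitMatrix M S t k u v :=
  wordSum_entries_nonneg (mul_entries_nonneg hM0 (proj_entries_nonneg S))
    (mul_entries_nonneg hM0 (proj_entries_nonneg Sᶜ)) t k u v

theorem visitMatrix_succ_mul_proj (t k : ℕ) :
    visitMatrix M S (t + 1) (k + 1) * proj S = visitMatrix M S t k * (M * proj S) := by
  unfold visitMatrix
  rw [wordSum_succ_succ, add_mul, mul_assoc, mul_assoc, mul_assoc, mul_assoc, proj_mul_proj,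
    proj_compl_mul_proj, mul_zero, mul_zero, add_zero]

theorem sum_visitMatrix (t : ℕ) (u v : V) :
    ∑ k ∈ Finset.range (t + 1), visitMatrix M S t k u v = (M ^ t) u v := by
  rw [← Matrix.sum_apply]
  unfold visitMatrix
  rw [sum_wordSum, mul_proj_add_mul_proj_compl]

theorem visitMatrix_le_pow (hM0 : ∀ u v, 0 ≤ M u v) (t k : ℕ) (u v : V) :
    visitMatrix M S t k u v ≤ (M ^ t) u v := by
  rcases lt_or_ge t k with h | h
  · rw [visitMatrix, wordSum_eq_zero _ _ h]
    exact pow_entries_nonneg hM0 t u v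
  · rw [← sum_visitMatrix S]
    exact Finset.single_le_sum (f := fun k => visitMatrix M S t k u v)
      (fun k _ => visitMatrix_nonneg S hM0 t k u v) (Finset.mem_range.2 (by omega))

theorem fewVisits_apply (K t : ℕ) (u : V) :
    fewVisits M S K t u = ∑ k ∈ Finset.range K, ∑ v, visitMatrix M S t k u v := by
  rw [fewVisits, mulVec_one_apply]
  simp only [Matrix.sum_apply]
  exact Finset.sum_comm

theorem fewVisits_nonneg (hM0 : ∀ u v, 0 ≤ M u v) (K t : ℕ) (u : V) : 0 ≤ fewVisits M S K t u := by
  rw [fewVisits_apply]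
  exact Finset.sum_nonneg fun k _ => Finset.sum_nonneg fun v _ => visitMatrix_nonneg S hM0 t k u v

theorem fewVisits_zero_right (K : ℕ) (u : V) : fewVisits M S (K + 1) 0 u = 1 := by
  rw [fewVisits, Finset.sum_range_succ']
  simp [visitMatrix, wordSum]

/-- Conditioning on the last step: the event of having at most `K` visits is lost exactly when the
`K + 1`-st visit happens. -/
theorem fewVisits_succ_right (hM1 : M *ᵥ 1 = 1) (K t : ℕ) (u : V) :
    fewVisits M S (K + 1) (t + 1) u =
      fewVisits M S (K + 1) t u - ∑ v ∈ S, visitMatrix M S (t + 1) (K + 1) u v := by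
  have h1 : ∑ k ∈ Finset.range (K + 1), visitMatrix M S (t + 1) k =
      (∑ k ∈ Finset.range (K + 1), visitMatrix M S t k) * M
        - visitMatrix M S (t + 1) (K + 1) * proj S := by
    rw [visitMatrix_succ_mul_proj, eq_sub_iff_add_eq]
    have e : ∀ X : Matrix V V ℝ, X * M = X * (M * proj S) + X * (M * proj Sᶜ) := fun X => by
      rw [← mul_add, mul_proj_add_mul_proj_compl]
    rw [e]
    unfold visitMatrix
    rw [sum_wordSum_succ, Finset.sum_range_succ _ K]
    simp only [add_mul]
    abel
  rw [fewVisits, fewVisits, h1, Matrix.sub_mulVec, ← Matrix.mulVec_mulVec, hM1, Pi.sub_apply]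
  congr 1
  rw [mulVec_one_apply]
  simp only [mul_proj_apply]
  rw [Finset.sum_ite_mem, Finset.univ_inter]

theorem fewVisits_antitone (hM0 : ∀ u v, 0 ≤ M u v) (hM1 : M *ᵥ 1 = 1) (K : ℕ) (u : V) :
    Antitone fun t => fewVisits M S K t u := by
  refine antitone_nat_of_succ_le fun t => ?_
  cases K with
  | zero => simp [fewVisits]
  | succ K =>
    rw [fewVisits_succ_right S hM1]
    have := Finset.sum_nonneg fun v (_ : v ∈ S) => visitMatrix_nonneg S hM0 (t + 1) (K + 1) u v
    linarith

/-- Conditioning on the first step, and summing over all starting points: the uniform distribution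
is stationary. -/
theorem sum_fewVisits_succ (hMs : M.transpose = M) (hM1 : M *ᵥ 1 = 1) (K t : ℕ) :
    ∑ u, fewVisits M S (K + 1) (t + 1) u =
      ∑ w ∈ S, fewVisits M S K t w + ∑ w ∈ Sᶜ, fewVisits M S (K + 1) t w := by
  have hcol : ∀ x : V → ℝ, ∑ u, (M *ᵥ x) u = ∑ w, x w := by
    intro x
    rw [← one_dotProduct, Matrix.dotProduct_mulVec, ← Matrix.mulVec_transpose, hMs, hM1,
      one_dotProduct]
  have hproj : ∀ (A : Finset V) (x : V → ℝ), ∑ w, (proj A *ᵥ x) w = ∑ w ∈ A, x w := by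
    intro A x
    simp [proj, Matrix.mulVec_diagonal, Finset.sum_ite_mem]
  have h : fewVisits M S (K + 1) (t + 1) =
      M *ᵥ (proj S *ᵥ fewVisits M S K t) + M *ᵥ (proj Sᶜ *ᵥ fewVisits M S (K + 1) t) := by
    unfold fewVisits visitMatrix
    rw [sum_wordSum_succ_left, Matrix.add_mulVec]
    simp only [Matrix.mulVec_mulVec, mul_assoc]
  rw [h]
  simp only [Pi.add_apply]
  rw [Finset.sum_add_distrib, hcol, hcol, hproj, hproj]

/-- A finite form of Kac's formula: from a uniform starting point in `S`, the walk rarely spends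
fewer than `K` of `L` steps in `S`. The quantity `∑ j < K, ∑ u, fewVisits (j + 1) t u`, which starts
at `K * |V|`, decreases by `∑ s ∈ S, fewVisits K t s` in step `t`. -/
theorem mul_sum_fewVisits_le (hM0 : ∀ u v, 0 ≤ M u v) (hMs : M.transpose = M) (hM1 : M *ᵥ 1 = 1)
    (K L : ℕ) :
    (L : ℝ) * ∑ s ∈ S, fewVisits M S K L s ≤ K * Fintype.card V := by
  set Φ : ℕ → ℝ := fun t => ∑ j ∈ Finset.range K, ∑ u, fewVisits M S (j + 1) t u with hΦ
  have hstep : ∀ t, ∑ s ∈ S, fewVisits M S K t s = Φ t - Φ (t + 1) := by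
    intro t
    have h1 : ∀ j, ∑ u, fewVisits M S (j + 1) t u - ∑ u, fewVisits M S (j + 1) (t + 1) u =
        ∑ w ∈ S, fewVisits M S (j + 1) t w - ∑ w ∈ S, fewVisits M S j t w := by
      intro j
      rw [sum_fewVisits_succ S hMs hM1, ← Finset.sum_add_sum_compl S]
      ring
    simp only [hΦ]
    rw [← Finset.sum_sub_distrib, Finset.sum_congr rfl fun j _ => h1 j,
      Finset.sum_range_sub fun j => ∑ w ∈ S, fewVisits M S j t w]
    simp [fewVisits]
  have hsum : ∑ t ∈ Finset.range L, ∑ s ∈ S, fewVisits M S K t s = Φ 0 - Φ L := by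
    rw [Finset.sum_congr rfl fun t _ => hstep t, Finset.sum_range_sub']
  have hΦ0 : Φ 0 = K * Fintype.card V := by
    simp only [hΦ, fewVisits_zero_right]
    simp
  have hΦL : 0 ≤ Φ L := Finset.sum_nonneg fun j _ => Finset.sum_nonneg fun u _ =>
    fewVisits_nonneg S hM0 (j + 1) L u
  have hle : ∑ _t ∈ Finset.range L, ∑ s ∈ S, fewVisits M S K L s ≤
      ∑ t ∈ Finset.range L, ∑ s ∈ S, fewVisits M S K t s :=
    Finset.sum_le_sum fun t ht => Finset.sum_le_sum fun s _ =>
      fewVisits_antitone S hM0 hM1 K s (Finset.mem_range.1 ht).le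
  rw [Finset.sum_const, Finset.card_range, nsmul_eq_mul] at hle
  linarith

/-! ### The walk watched on a set -/

/-- The transition matrix of the walk watched only when it is in `S`, restricted to excursions of
length at most `T`. -/
def returnKernel (M : Matrix V V ℝ) (S : Finset V) (T : ℕ) : Matrix V V ℝ :=
  proj S * (∑ j ∈ Finset.range T, (M * proj Sᶜ) ^ j) * (M * proj S)

/-- Entry `(u, v)` is the probability that the `k`-th visit to `S` of a walk from `u` takes place
at `v` and within the first `T` steps (for `u`, `v` in `S`). -/
def visitWithin (M : Matrix V V ℝ) (S : Finset V) (T k : ℕ) : Matrix V V ℝ :=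
  ∑ t ∈ Finset.range (T + 1), proj S * visitMatrix M S t k * proj S

theorem returnKernel_transpose (hMs : M.transpose = M) (T : ℕ) :
    (returnKernel M S T).transpose = returnKernel M S T := by
  have h : ∀ j, M * (proj Sᶜ * M) ^ j = (M * proj Sᶜ) ^ j * M := fun j =>
    (SemiconjBy.pow_right (show SemiconjBy M (proj Sᶜ * M) (M * proj Sᶜ) by
      rw [SemiconjBy, mul_assoc]) j).eq
  simp only [returnKernel, Matrix.transpose_mul, Matrix.transpose_sum, Matrix.transpose_pow,
    proj_transpose, hMs, Finset.mul_sum, Finset.sum_mul]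
  refine Finset.sum_congr rfl fun j _ => ?_
  rw [← mul_assoc, mul_assoc (proj S) M, h]
  simp only [mul_assoc]

theorem returnKernel_nonneg (hM0 : ∀ u v, 0 ≤ M u v) (T : ℕ) (u v : V) :
    0 ≤ returnKernel M S T u v := by
  refine mul_entries_nonneg (mul_entries_nonneg (proj_entries_nonneg S) fun u v => ?_)
    (mul_entries_nonneg hM0 (proj_entries_nonneg S)) u v
  rw [Matrix.sum_apply]
  exact Finset.sum_nonneg fun j _ =>
    pow_entries_nonneg (mul_entries_nonneg hM0 (proj_entries_nonneg Sᶜ)) j u v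

theorem sum_returnKernel_le_one (hM0 : ∀ u v, 0 ≤ M u v) (hM1 : M *ᵥ 1 = 1) (T : ℕ) (u : V) :
    ∑ v, returnKernel M S T u v ≤ 1 := by
  have h1 : (M * proj S) *ᵥ (1 : V → ℝ) = (1 - M * proj Sᶜ) *ᵥ 1 := by
    rw [Matrix.sub_mulVec, Matrix.one_mulVec, eq_sub_iff_add_eq, ← Matrix.add_mulVec,
      mul_proj_add_mul_proj_compl, hM1]
  have h2 : returnKernel M S T *ᵥ 1 = proj S *ᵥ (1 - (M * proj Sᶜ) ^ T *ᵥ 1) := by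
    rw [returnKernel, ← Matrix.mulVec_mulVec, h1, Matrix.mulVec_mulVec, mul_assoc,
      geom_sum_mul_neg, ← Matrix.mulVec_mulVec, Matrix.sub_mulVec, Matrix.one_mulVec]
  have h3 : ∑ v, returnKernel M S T u v = (returnKernel M S T *ᵥ 1) u := by
    rw [mulVec_one_apply]
  have h4 : 0 ≤ ((M * proj Sᶜ) ^ T *ᵥ (1 : V → ℝ)) u := by
    rw [mulVec_one_apply]
    exact Finset.sum_nonneg fun v _ =>
      pow_entries_nonneg (mul_entries_nonneg hM0 (proj_entries_nonneg Sᶜ)) T u v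
  rw [h3, h2, proj, Matrix.mulVec_diagonal, Pi.sub_apply, Pi.one_apply]
  split_ifs <;> linarith

theorem le_returnKernel (hM0 : ∀ u v, 0 ≤ M u v) {T : ℕ} (hT : 0 < T) {u v : V} (hu : u ∈ S)
    (hv : v ∈ S) : M u v ≤ returnKernel M S T u v := by
  obtain ⟨T, rfl⟩ := Nat.exists_eq_succ_of_ne_zero hT.ne'
  rw [returnKernel, Finset.sum_range_succ', pow_zero, mul_add, add_mul, mul_one, Matrix.add_apply,
    proj_mul_apply (M * proj S), if_pos hu, mul_proj_apply, if_pos hv]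
  refine le_add_of_nonneg_left (mul_entries_nonneg (mul_entries_nonneg (proj_entries_nonneg S)
    fun u v => ?_) (mul_entries_nonneg hM0 (proj_entries_nonneg S)) u v)
  rw [Matrix.sum_apply]
  exact Finset.sum_nonneg fun j _ =>
    pow_entries_nonneg (mul_entries_nonneg hM0 (proj_entries_nonneg Sᶜ)) (j + 1) u v

theorem returnKernel_eq_zero {T : ℕ} {u v : V} (hu : u ∉ S) : returnKernel M S T u v = 0 := by
  rw [returnKernel, mul_assoc, proj_mul_apply, if_neg hu]

theorem visitWithin_apply {T k : ℕ} {u v : V} :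
    visitWithin M S T k u v = if u ∈ S ∧ v ∈ S then
      ∑ t ∈ Finset.range (T + 1), visitMatrix M S t k u v else 0 := by
  rw [visitWithin, Matrix.sum_apply]
  simp only [mul_proj_apply, proj_mul_apply]
  by_cases hu : u ∈ S <;> by_cases hv : v ∈ S <;> simp [hu, hv]

theorem visitWithin_nonneg (hM0 : ∀ u v, 0 ≤ M u v) (T k : ℕ) (u v : V) :
    0 ≤ visitWithin M S T k u v := by
  rw [visitWithin_apply]
  split_ifs
  · exact Finset.sum_nonneg fun t _ => visitMatrix_nonneg S hM0 t k u v
  · exact le_rfl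

theorem visitWithin_zero_right {T : ℕ} {u : V} (hu : u ∈ S) (v : V) :
    visitWithin M S T 0 u v = if u = v then 1 else 0 := by
  have hpos : ∀ t, proj S * visitMatrix M S (t + 1) 0 * proj S = 0 := by
    intro t
    rw [visitMatrix, wordSum_succ_zero, mul_assoc, mul_assoc, mul_assoc, proj_compl_mul_proj]
    simp only [mul_zero]
  rw [visitWithin, Finset.sum_range_succ', Finset.sum_eq_zero fun t _ => hpos t, zero_add,
    visitMatrix, wordSum, mul_one, proj_mul_proj, proj, Matrix.diagonal_apply, if_pos hu]

/-- Successive visits are separated by an excursion, and every excursion within a walk of length at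
most `T` has length at most `T`. -/
theorem visitWithin_succ_le (hM0 : ∀ u v, 0 ≤ M u v) (T k : ℕ) (u v : V) :
    visitWithin M S T (k + 1) u v ≤ ∑ x, visitWithin M S T k u x * returnKernel M S T x v := by
  set b := M * proj Sᶜ with hb
  set g : ℕ → ℕ → Matrix V V ℝ := fun m j =>
    proj S * visitMatrix M S m k * proj S * b ^ j * (M * proj S) with hg
  have hb0 : ∀ u v, 0 ≤ b u v := mul_entries_nonneg hM0 (proj_entries_nonneg Sᶜ)
  have hg0 : ∀ m j u v, 0 ≤ g m j u v := fun m j => mul_entries_nonneg (mul_entries_nonneg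
    (mul_entries_nonneg (mul_entries_nonneg (proj_entries_nonneg S) (visitMatrix_nonneg S hM0 m k))
      (proj_entries_nonneg S)) (pow_entries_nonneg hb0 j))
      (mul_entries_nonneg hM0 (proj_entries_nonneg S))
  have hleft : visitWithin M S T (k + 1) =
      ∑ t ∈ Finset.range T, ∑ j ∈ Finset.range (t + 1), g (t - j) j := by
    have h0 : proj S * visitMatrix M S 0 (k + 1) * proj S = 0 := by simp [visitMatrix, wordSum]
    rw [visitWithin, Finset.sum_range_succ', h0, add_zero]
    refine Finset.sum_congr rfl fun t _ => ?_
    have e : proj S * visitMatrix M S t k =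
        ∑ j ∈ Finset.range (t + 1), proj S * visitMatrix M S (t - j) k * proj S * b ^ j :=
      mul_wordSum_eq_sum (proj_mul_proj S) (by rw [mul_assoc, proj_mul_proj])
        (by rw [mul_assoc, proj_compl_mul_proj, mul_zero]) t k
    rw [mul_assoc, visitMatrix_succ_mul_proj, ← mul_assoc, e, Finset.sum_mul]
  have hright : visitWithin M S T k * returnKernel M S T =
      ∑ m ∈ Finset.range (T + 1), ∑ j ∈ Finset.range T, g m j := by
    rw [visitWithin, returnKernel, Finset.sum_mul]
    refine Finset.sum_congr rfl fun m _ => ?_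
    rw [← mul_assoc _ _ (M * proj S), ← mul_assoc _ (proj S), mul_assoc _ (proj S) (proj S),
      proj_mul_proj, Finset.mul_sum, Finset.sum_mul]
  rw [← Matrix.mul_apply, hright, hleft]
  simp only [Matrix.sum_apply]
  rw [Finset.sum_range_diag_flip T fun j m => g m j u v, Finset.sum_comm
    (s := Finset.range (T + 1))]
  refine Finset.sum_le_sum fun j _ => ?_
  exact Finset.sum_le_sum_of_subset_of_nonneg (Finset.range_mono (by omega))
    fun m _ _ => hg0 m j u v

theorem visitMatrix_le_visitWithin (hM0 : ∀ u v, 0 ≤ M u v) {T t : ℕ} (ht : t ≤ T) (k : ℕ)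
    {u v : V} (hu : u ∈ S) (hv : v ∈ S) :
    visitMatrix M S t k u v ≤ visitWithin M S T k u v := by
  rw [visitWithin_apply, if_pos ⟨hu, hv⟩]
  exact Finset.single_le_sum (f := fun t => visitMatrix M S t k u v)
    (fun t _ => visitMatrix_nonneg S hM0 t k u v) (Finset.mem_range.2 (by omega))

theorem visitWithin_le_sum_pow (hM0 : ∀ u v, 0 ≤ M u v) (T k : ℕ) (u v : V) :
    visitWithin M S T k u v ≤ ∑ t ∈ Finset.range (T + 1), (M ^ t) u v := by
  rw [visitWithin_apply]
  split_ifs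
  · exact Finset.sum_le_sum fun t _ => visitMatrix_le_pow S hM0 t k u v
  · exact Finset.sum_nonneg fun t _ => pow_entries_nonneg hM0 t u v

/-- A walk that does not make at most `K` visits in `T` steps makes its `K + 1`-st visit somewhere,
within `T` steps. -/
theorem one_sub_fewVisits_le (hM0 : ∀ u v, 0 ≤ M u v) (hM1 : M *ᵥ 1 = 1) (K T : ℕ) {s : V}
    (hs : s ∈ S) :
    1 - fewVisits M S (K + 1) T s ≤ ∑ v, visitWithin M S T (K + 1) s v := by
  have hsum : 1 - fewVisits M S (K + 1) T s =
      ∑ t ∈ Finset.range T, ∑ v ∈ S, visitMatrix M S (t + 1) (K + 1) s v := by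
    have h : ∀ t ∈ Finset.range T, ∑ v ∈ S, visitMatrix M S (t + 1) (K + 1) s v =
        fewVisits M S (K + 1) t s - fewVisits M S (K + 1) (t + 1) s := fun t _ => by
      rw [fewVisits_succ_right S hM1]
      ring
    rw [Finset.sum_congr rfl h, Finset.sum_range_sub' fun t => fewVisits M S (K + 1) t s,
      fewVisits_zero_right]
  have hS : ∑ v ∈ S, visitWithin M S T (K + 1) s v ≤ ∑ v, visitWithin M S T (K + 1) s v :=
    Finset.sum_le_sum_of_subset_of_nonneg (Finset.subset_univ S)
      fun v _ _ => visitWithin_nonneg S hM0 T (K + 1) s v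
  refine le_trans ?_ hS
  rw [hsum, Finset.sum_comm]
  refine Finset.sum_le_sum fun v hv => ?_
  rw [visitWithin_apply, if_pos ⟨hs, hv⟩, Finset.sum_range_succ']
  exact le_add_of_nonneg_right (visitMatrix_nonneg S hM0 0 (K + 1) s v)

/-- If all nonempty subsets of `Z ⊆ S` have large boundary in `S` and the points of `S` off `Z` are
hard to reach from `s` within `T` steps, then the `k`-th visit to `S` within `T` steps is spread
out. -/
theorem spreadBound_visitWithin (hM0 : ∀ u v, 0 ≤ M u v) (hMs : M.transpose = M)
    (hM1 : M *ᵥ 1 = 1) (hMlazy : ∀ u, 1 / 2 ≤ M u u) {T : ℕ} (hT : 0 < T) {Z : Finset V}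
    (hZS : Z ⊆ S) {φ θ : ℝ} (hφ : 0 ≤ φ) (hφ1 : φ ≤ 1) (hθ : 0 ≤ θ)
    (hcut : ∀ X ⊆ Z, X.Nonempty → φ * X.card ≤ ∑ u ∈ X, ∑ v ∈ S \ X, M u v) {s : V} (hs : s ∈ S)
    (hsmall : ∀ v ∈ S, v ∉ Z → ∑ t ∈ Finset.range (T + 1), (M ^ t) s v ≤ θ) (k : ℕ) :
    SpreadBound (visitWithin M S T k s) ((1 - φ ^ 2 / 2) ^ k) θ := by
  have hP0 := returnKernel_nonneg S hM0 T
  have hPs : ∀ u v, returnKernel M S T u v = returnKernel M S T v u := fun u v => by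
    conv_lhs => rw [← returnKernel_transpose S hMs T, Matrix.transpose_apply]
  have hP1 := sum_returnKernel_le_one S hM0 hM1 T
  have hdiag : ∀ u ∈ S, 1 / 2 ≤ returnKernel M S T u u := fun u hu =>
    (hMlazy u).trans (le_returnKernel S hM0 hT hu hu)
  have hout : ∀ X ⊆ Z, ∀ u ∉ X, ∑ v ∈ X, returnKernel M S T u v ≤ 1 / 2 := by
    intro X hX u hu
    by_cases huS : u ∈ S
    · have h1 : ∑ v ∈ insert u X, returnKernel M S T u v ≤ 1 :=
        (Finset.sum_le_sum_of_subset_of_nonneg (Finset.subset_univ _)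
          fun v _ _ => hP0 u v).trans (hP1 u)
      rw [Finset.sum_insert hu] at h1
      linarith [hdiag u huS]
    · rw [Finset.sum_eq_zero fun v _ => returnKernel_eq_zero S huS]
      norm_num
  have hcutP : ∀ X ⊆ Z, X.Nonempty →
      φ * X.card ≤ ∑ u ∈ X, ∑ v ∈ Xᶜ, returnKernel M S T u v := by
    intro X hX hne
    refine (hcut X hX hne).trans (Finset.sum_le_sum fun u hu => ?_)
    refine (Finset.sum_le_sum fun v hv => le_returnKernel S hM0 hT (hZS (hX hu))
      (Finset.mem_sdiff.1 hv).1).trans ?_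
    exact Finset.sum_le_sum_of_subset_of_nonneg (fun v hv =>
      Finset.mem_compl.2 (Finset.mem_sdiff.1 hv).2) fun v _ _ => hP0 u v
  induction k with
  | zero =>
    have : visitWithin M S T 0 s = fun v => if s = v then 1 else 0 :=
      funext fun v => visitWithin_zero_right S hs v
    rw [this, pow_zero]
    exact spreadBound_single s hθ
  | succ k ih =>
    rw [pow_succ]
    refine SpreadBound.step hP0 hPs hP1 (fun u hu => hdiag u (hZS hu)) hout hφ hφ1 hcutP
      (pow_nonneg (by nlinarith) k) hθ ih (visitWithin_succ_le S hM0 T k s) fun v hv => ?_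
    by_cases hvS : v ∈ S
    · exact (visitWithin_le_sum_pow S hM0 T (k + 1) s v).trans (hsmall v hvS hv)
    · rw [visitWithin_apply, if_neg fun h => hvS h.2]
      exact hθ

end Visits

/-! ### The lazy walk on a graph of bounded degree -/

section LazyWalk

open Matrix

variable {V : Type*} [Fintype V] [DecidableEq V] {G : SimpleGraph V} [DecidableRel G.Adj] {d : ℕ}

theorem half_le_walkMatrix_self (hd : 0 < d) (hdeg : ∀ v, G.degree v ≤ d) (u : V) :
    1 / 2 ≤ walkMatrix G d u u := by
  have h : (G.degree u : ℝ) ≤ d := by exact_mod_cast hdeg u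
  have hd' : (0 : ℝ) < d := by exact_mod_cast hd
  have : (G.degree u : ℝ) / (2 * d) ≤ 1 / 2 := by
    rw [div_le_div_iff₀ (by positivity) (by norm_num)]
    linarith
  simp only [walkMatrix, Matrix.of_apply, stepProb, if_true]
  linarith

theorem walkMatrix_nonneg (hd : 0 < d) (hdeg : ∀ v, G.degree v ≤ d) (u v : V) :
    0 ≤ walkMatrix G d u v := by
  by_cases h : u = v
  · subst h
    exact le_trans (by norm_num) (half_le_walkMatrix_self hd hdeg u)
  · simp only [walkMatrix, Matrix.of_apply, stepProb, if_neg h]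
    split_ifs <;> positivity

theorem walkMatrix_transpose : (walkMatrix G d).transpose = walkMatrix G d := by
  ext u v
  simp only [Matrix.transpose_apply, walkMatrix, Matrix.of_apply, stepProb, G.adj_comm u v,
    eq_comm (a := u) (b := v)]
  split_ifs with h
  · rw [h]
  · rfl
  · rfl

theorem walkMatrix_mulVec_one : walkMatrix G d *ᵥ 1 = 1 := by
  ext u
  have h : ∀ v, walkMatrix G d u v = (if u = v then 1 - (G.degree u : ℝ) / (2 * d) else 0) +
      if G.Adj u v then 1 / (2 * (d : ℝ)) else 0 := by
    intro v
    simp only [walkMatrix, Matrix.of_apply, stepProb]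
    by_cases huv : u = v
    · subst huv
      simp
    · simp [huv]
  rw [mulVec_one_apply, Finset.sum_congr rfl fun v _ => h v, Finset.sum_add_distrib,
    Finset.sum_ite_eq, if_pos (Finset.mem_univ u), ← Finset.sum_filter, Finset.sum_const,
    ← G.neighborFinset_eq_filter, G.card_neighborFinset_eq_degree, nsmul_eq_mul, Pi.one_apply]
  ring

theorem sum_walkMatrix_eq_interedges (X Y : Finset V) (hXY : Disjoint X Y) :
    ∑ u ∈ X, ∑ v ∈ Y, walkMatrix G d u v = ((G.interedges X Y).card : ℝ) / (2 * d) := by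
  have h : ∀ u ∈ X, ∀ v ∈ Y, walkMatrix G d u v = if G.Adj u v then 1 / (2 * (d : ℝ)) else 0 := by
    intro u hu v hv
    have : u ≠ v := fun huv => Finset.disjoint_left.1 hXY hu (huv ▸ hv)
    simp [walkMatrix, stepProb, this]
  rw [Finset.sum_congr rfl fun u hu => Finset.sum_congr rfl fun v hv => h u hu v hv,
    ← Finset.sum_product' X Y fun u v => if G.Adj u v then 1 / (2 * (d : ℝ)) else 0,
    ← Finset.sum_filter, Finset.sum_const, nsmul_eq_mul]
  rw [SimpleGraph.interedges, Rel.interedges]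
  ring

theorem returnProb_nonneg (hd : 0 < d) (hdeg : ∀ v, G.degree v ≤ d) (ℓ : ℕ) (S : Finset V) (i : ℕ)
    (s u : V) : 0 ≤ returnProb G d ℓ S i s u :=
  Finset.sum_nonneg fun w _ => Finset.prod_nonneg fun k _ =>
    walkMatrix_nonneg hd hdeg (w k.castSucc) (w k.succ)

theorem returnProb_le_pow (hd : 0 < d) (hdeg : ∀ v, G.degree v ≤ d) (ℓ : ℕ) (S : Finset V) (i : ℕ)
    (s u : V) : returnProb G d ℓ S i s u ≤ (walkMatrix G d ^ (2 ^ i * ℓ)) s u := by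
  rw [← reachProb_eq_pow]
  unfold returnProb reachProb walkProb
  refine Finset.sum_le_sum_of_subset_of_nonneg (fun w hw => ?_) fun w _ _ =>
    Finset.prod_nonneg fun k _ => walkMatrix_nonneg hd hdeg (w k.castSucc) (w k.succ)
  simp only [Finset.mem_filter] at hw ⊢
  exact ⟨hw.1, hw.2.1, hw.2.2.1⟩

theorem sum_returnProb_le_one (hd : 0 < d) (hdeg : ∀ v, G.degree v ≤ d) (ℓ : ℕ) (S : Finset V)
    (i : ℕ) (s : V) : ∑ u ∈ S, returnProb G d ℓ S i s u ≤ 1 := by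
  have hrow : ∀ t, (walkMatrix G d ^ t) *ᵥ (1 : V → ℝ) = 1 := by
    intro t
    induction t with
    | zero => simp
    | succ t ih => rw [pow_succ, ← Matrix.mulVec_mulVec, walkMatrix_mulVec_one, ih]
  have h1 : ∑ u, (walkMatrix G d ^ (2 ^ i * ℓ)) s u = 1 := by
    rw [← mulVec_one_apply, hrow, Pi.one_apply]
  rw [← h1]
  exact (Finset.sum_le_sum fun u _ => returnProb_le_pow hd hdeg ℓ S i s u).trans
    (Finset.sum_le_sum_of_subset_of_nonneg (Finset.subset_univ S) fun u _ _ =>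
      pow_entries_nonneg (walkMatrix_nonneg hd hdeg) _ s u)

theorem returnProb_symm {ℓ : ℕ} (hℓ : 0 < ℓ) {S : Finset V} (i : ℕ) {s u : V} (hs : s ∈ S)
    (hu : u ∈ S) : returnProb G d ℓ S i s u = returnProb G d ℓ S i u s := by
  rw [returnProb_eq_pow G d hℓ, returnProb_eq_pow G d hℓ]
  set A := walkMatrix G d ^ ℓ with hA
  have hAt : A.transpose = A := by rw [hA, Matrix.transpose_pow, walkMatrix_transpose]
  have hsym : (proj S * (A * proj S) ^ 2 ^ i).transpose = proj S * (A * proj S) ^ 2 ^ i := by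
    rw [Matrix.transpose_mul, Matrix.transpose_pow, Matrix.transpose_mul, proj_transpose, hAt]
    exact (SemiconjBy.pow_right (show SemiconjBy (proj S) (A * proj S) (proj S * A) by
      rw [SemiconjBy, mul_assoc]) (2 ^ i)).eq.symm
  have h := congrFun (congrFun hsym u) s
  rw [Matrix.transpose_apply, proj_mul_apply, proj_mul_apply, if_pos hs, if_pos hu] at h
  exact h

/-- A return at level `i + 1` is two consecutive returns at level `i`, so the Cauchy–Schwarz
inequality turns a bound on the norms at level `i` into a pointwise bound at level `i + 1`. -/
theorem returnProb_succ_le {ℓ : ℕ} (hℓ : 0 < ℓ) {S : Finset V} {i : ℕ} {B : ℝ}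
    (hB : ∀ s ∈ S, returnNormSq G d ℓ S i s ≤ B) {s v : V} (hs : s ∈ S) (hv : v ∈ S) :
    returnProb G d ℓ S (i + 1) s v ≤ B := by
  have hzero : ∀ x ∉ S, returnProb G d ℓ S i s x = 0 := by
    intro x hx
    obtain ⟨m, hm⟩ := Nat.exists_eq_succ_of_ne_zero (pow_ne_zero i two_ne_zero : (2 : ℕ) ^ i ≠ 0)
    rw [returnProb_eq_pow G d hℓ, hm, Nat.succ_eq_add_one, pow_succ, ← mul_assoc, mul_proj_apply,
      if_neg hx]
  have hsplit : returnProb G d ℓ S (i + 1) s v =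
      ∑ x ∈ S, returnProb G d ℓ S i s x * returnProb G d ℓ S i v x := by
    rw [returnProb_eq_pow G d hℓ, pow_succ 2 i, mul_two, pow_add, Matrix.mul_apply,
      ← Finset.sum_subset (Finset.subset_univ S)]
    · refine Finset.sum_congr rfl fun x hx => ?_
      rw [returnProb_symm hℓ i hv hx, returnProb_eq_pow G d hℓ, returnProb_eq_pow G d hℓ]
    · intro x _ hx
      rw [← returnProb_eq_pow G d hℓ, hzero x hx, zero_mul]
  have hle : ∑ x ∈ S, returnProb G d ℓ S i s x * returnProb G d ℓ S i v x ≤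
      ∑ x ∈ S, (returnProb G d ℓ S i s x ^ 2 / 2 + returnProb G d ℓ S i v x ^ 2 / 2) :=
    Finset.sum_le_sum fun x _ => by
      nlinarith [sq_nonneg (returnProb G d ℓ S i s x - returnProb G d ℓ S i v x)]
  rw [Finset.sum_add_distrib, ← Finset.sum_div, ← Finset.sum_div] at hle
  have h1 := hB s hs
  have h2 := hB v hv
  unfold returnNormSq at h1 h2
  rw [hsplit]
  linarith

/-- Let `F` bound the probability that fewer than `K` of the first `ℓ` steps from `s` are in `S`.
If there were no set `P` as claimed, every `k`-th visit to `S` with `k ≥ K` would give each vertex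
at most `(1 - φ ^ 2 / 2) ^ K + θ`. Either alternative in `h` contradicts this: the first says that
the return vector of `s` is too concentrated, the second that the total mass of the `K`-th visit
exceeds what this bound allows to the whole of `V`. -/
theorem exists_sparse_of_concentrated (hd : 0 < d) (hdeg : ∀ v, G.degree v ≤ d) {S : Finset V}
    {s : V} (hs : s ∈ S) {ℓ i K T : ℕ} (hK : 0 < K) (hLT : 2 ^ (i + 1) * ℓ ≤ T) (hℓ : 0 < ℓ)
    {B F φ θ η : ℝ} (hB : ∀ v ∈ S, returnProb G d ℓ S (i + 1) s v ≤ B)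
    (hF : fewVisits (walkMatrix G d) S K ℓ s ≤ F) (hB0 : 0 ≤ B)
    (hφ : 0 ≤ φ) (hφ1 : φ ≤ 1) (hθ : 0 ≤ θ) (hηθ : (T + 1) * η ≤ θ)
    (h : B * F + ((2 ^ (i + 1) * ℓ : ℕ) : ℝ) * ((1 - φ ^ 2 / 2) ^ K + θ) <
        returnNormSq G d ℓ S (i + 1) s ∨
      (1 - φ ^ 2 / 2) ^ K * √(Fintype.card V) + θ * Fintype.card V < 1 - F) :
    ∃ P ⊆ S, P.Nonempty ∧ ((G.interedges P (S \ P)).card : ℝ) ≤ 2 * φ * d * P.card ∧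
      ∀ v ∈ P, ∃ t ≤ T, η ≤ reachProb G d t s v := by
  classical
  by_contra hcon
  push Not at hcon
  set M := walkMatrix G d with hM
  set L := 2 ^ (i + 1) * ℓ with hL
  set r := 1 - φ ^ 2 / 2 with hr
  have hd' : (0 : ℝ) < d := by exact_mod_cast hd
  have hr0 : 0 ≤ r := by rw [hr]; nlinarith
  have hr1 : r ≤ 1 := by rw [hr]; nlinarith [sq_nonneg φ]
  have hM0 := walkMatrix_nonneg hd hdeg
  have hM1 : M *ᵥ 1 = 1 := walkMatrix_mulVec_one
  have hLℓ : ℓ ≤ L := Nat.le_mul_of_pos_left ℓ (by positivity)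
  have hT0 : 0 < T := by omega
  have hanti := fewVisits_antitone S hM0 hM1 K s
  set Z : Finset V := S.filter fun v => ∃ t ≤ T, η ≤ reachProb G d t s v with hZ
  have hZS : Z ⊆ S := Finset.filter_subset _ S
  have hspread : ∀ k, SpreadBound (visitWithin M S T k s) (r ^ k) θ := by
    refine spreadBound_visitWithin S hM0 walkMatrix_transpose hM1
      (half_le_walkMatrix_self hd hdeg) hT0 hZS hφ hφ1 hθ
      (fun X hX hne => ?_) hs fun v hv hvZ => ?_
    · by_contra hlt
      obtain ⟨v, hv, hvt⟩ := hcon X (hX.trans hZS) hne (by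
        rw [sum_walkMatrix_eq_interedges X (S \ X) Finset.disjoint_sdiff, not_le,
          div_lt_iff₀ (by positivity)] at hlt
        linarith)
      obtain ⟨t, ht, hle⟩ := (Finset.mem_filter.1 (hX hv)).2
      exact absurd hle (not_le.2 (hvt t ht))
    · have hlt : ∀ t ∈ Finset.range (T + 1), (M ^ t) s v ≤ η := by
        intro t ht
        by_contra hlt
        refine hvZ (Finset.mem_filter.2 ⟨hv, t, Nat.lt_succ_iff.1 (Finset.mem_range.1 ht), ?_⟩)
        rw [reachProb_eq_pow]
        exact (not_le.1 hlt).le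
      refine (Finset.sum_le_sum hlt).trans ?_
      rw [Finset.sum_const, Finset.card_range, nsmul_eq_mul]
      push_cast
      exact hηθ
  rcases h with h | h
  · -- Pair the return vector with the distribution after `L` steps, split by the number of visits.
    have hpoint : ∀ v ∈ S, returnProb G d ℓ S (i + 1) s v ≤
        ∑ k ∈ Finset.range K, visitMatrix M S L k s v + L * (r ^ K + θ) := by
      intro v hv
      refine (returnProb_le_pow hd hdeg ℓ S (i + 1) s v).trans ?_
      rw [← hM, ← hL, ← sum_visitMatrix S]
      have hsub : Finset.range (L + 1) ⊆ Finset.range K ∪ Finset.Ico K (L + 1) := by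
        intro k hk
        rw [Finset.mem_union, Finset.mem_range, Finset.mem_Ico]
        rw [Finset.mem_range] at hk
        omega
      refine (Finset.sum_le_sum_of_subset_of_nonneg hsub fun k _ _ =>
        visitMatrix_nonneg S hM0 L k s v).trans ?_
      rw [Finset.sum_union (by
        rw [Finset.disjoint_left]
        intro k hk hk'
        rw [Finset.mem_range] at hk
        rw [Finset.mem_Ico] at hk'
        omega)]
      refine add_le_add le_rfl ?_
      have hterm : ∀ k ∈ Finset.Ico K (L + 1), visitMatrix M S L k s v ≤ r ^ K + θ := by
        intro k hk
        refine (visitMatrix_le_visitWithin S hM0 hLT k hs hv).trans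
          (((hspread k).apply_le v).trans ?_)
        have := pow_le_pow_of_le_one hr0 hr1 (Finset.mem_Ico.1 hk).1
        linarith
      refine (Finset.sum_le_sum hterm).trans ?_
      rw [Finset.sum_const, Nat.card_Ico, nsmul_eq_mul]
      refine mul_le_mul_of_nonneg_right ?_ (add_nonneg (pow_nonneg hr0 K) hθ)
      exact_mod_cast (by omega : L + 1 - K ≤ L)
    have hsum : returnNormSq G d ℓ S (i + 1) s ≤
        ∑ v ∈ S, (B * ∑ k ∈ Finset.range K, visitMatrix M S L k s v +
          L * (r ^ K + θ) * returnProb G d ℓ S (i + 1) s v) := by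
      refine Finset.sum_le_sum fun v hv => ?_
      have hq := returnProb_nonneg hd hdeg ℓ S (i + 1) s v
      have hN : 0 ≤ ∑ k ∈ Finset.range K, visitMatrix M S L k s v :=
        Finset.sum_nonneg fun k _ => visitMatrix_nonneg S hM0 L k s v
      have h1 := mul_le_mul_of_nonneg_left (hpoint v hv) hq
      have h2 := mul_le_mul_of_nonneg_right (hB v hv) hN
      rw [sq]
      linarith
    rw [Finset.sum_add_distrib, ← Finset.mul_sum, ← Finset.mul_sum, Finset.sum_comm] at hsum
    have hfew : ∑ k ∈ Finset.range K, ∑ v ∈ S, visitMatrix M S L k s v ≤ F := by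
      refine le_trans ?_ ((hanti hLℓ).trans hF)
      simp only
      rw [fewVisits_apply]
      exact Finset.sum_le_sum fun k _ => Finset.sum_le_sum_of_subset_of_nonneg
        (Finset.subset_univ S) fun v _ _ => visitMatrix_nonneg S hM0 L k s v
    have h1 := mul_le_mul_of_nonneg_left hfew hB0
    have h2 := mul_le_mul_of_nonneg_left (sum_returnProb_le_one hd hdeg ℓ S (i + 1) s)
      (mul_nonneg (Nat.cast_nonneg (α := ℝ) L) (add_nonneg (pow_nonneg hr0 K) hθ))
    linarith
  · obtain ⟨K, rfl⟩ := Nat.exists_eq_succ_of_ne_zero hK.ne'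
    have h1 := one_sub_fewVisits_le S hM0 hM1 K T hs
    have h2 := (hspread (K + 1)).sum_le
    have h3 := (hanti (hLℓ.trans hLT)).trans hF
    simp only [Nat.succ_eq_add_one] at h h3
    linarith

end LazyWalk

/-! ### Asymptotic estimates and the choice of parameters -/

/-- The lower bounds that `n` has to meet: the third conjunct bounds `2 ^ i` when
`n ^ (δ * i) < n`, and the fourth lets the contraction of the curve argument beat powers of
`n`. -/
theorem eventually_large (δ : ℝ) (hδ : 0 < δ) :
    ∀ᶠ n : ℕ in Filter.atTop, 1 ≤ n ∧ 1000 ≤ (n : ℝ) ^ δ ∧ 64 * (2 : ℝ) ^ (1 / δ) ≤ (n : ℝ) ^ δ ∧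
      4 * n * ((n : ℝ) ^ δ) ^ 2 * Real.exp (-((n : ℝ) ^ (δ / 4)) ^ 2 / 4) ≤ 1 := by
  have hpow : ∀ a : ℝ, 0 < a →
      Filter.Tendsto (fun n : ℕ => (n : ℝ) ^ a) Filter.atTop Filter.atTop := fun a ha =>
    (tendsto_rpow_atTop ha).comp tendsto_natCast_atTop_atTop
  have h1 := (hpow δ hδ).eventually_ge_atTop 1000
  have h2 := (hpow δ hδ).eventually_ge_atTop (64 * (2 : ℝ) ^ (1 / δ))
  have h3 := ((tendsto_rpow_mul_exp_neg_mul_atTop_nhds_zero (2 / δ + 4) (1 / 4)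
    (by norm_num)).comp (hpow (δ / 2) (by positivity))).eventually_le_const
    (show (0 : ℝ) < 1 / 4 by norm_num)
  filter_upwards [Filter.eventually_ge_atTop 1, h1, h2, h3] with n hn h1 h2 h3
  refine ⟨hn, h1, h2, ?_⟩
  have hn0 : (0 : ℝ) < n := by exact_mod_cast hn
  have e1 : ((n : ℝ) ^ (δ / 2)) ^ (2 / δ + 4) = n * ((n : ℝ) ^ δ) ^ 2 := by
    rw [← Real.rpow_mul hn0.le, ← Real.rpow_natCast ((n : ℝ) ^ δ), ← Real.rpow_mul hn0.le]
    nth_rewrite 2 [← Real.rpow_one (n : ℝ)]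
    rw [← Real.rpow_add hn0]
    congr 1
    push_cast
    field_simp
    ring
  have e2 : ((n : ℝ) ^ (δ / 4)) ^ 2 = (n : ℝ) ^ (δ / 2) := by
    rw [← Real.rpow_natCast, ← Real.rpow_mul hn0.le]
    congr 1
    push_cast
    ring
  simp only [Function.comp_apply] at h3
  rw [e1] at h3
  rw [e2]
  have e3 : -(n : ℝ) ^ (δ / 2) / 4 = -(1 / 4) * (n : ℝ) ^ (δ / 2) := by ring
  rw [e3]
  linarith

/-- Each step with conductance `1 / w` contracts by the factor `1 - 1 / (2 w ^ 2)`; over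
`⌊w ^ 4⌋ ≥ w ^ 4 / 2` steps the product is exponentially small in `w ^ 2`. -/
theorem pow_floor_le_exp {w : ℝ} (hw : 2 ≤ w) :
    (1 - (1 / w) ^ 2 / 2) ^ ⌊w ^ 4⌋₊ ≤ Real.exp (-w ^ 2 / 4) := by
  have hw0 : 0 < w := by linarith
  have hw4 : 2 ≤ w ^ 4 := by nlinarith [pow_le_pow_left₀ (by norm_num) hw 4]
  have hK : w ^ 4 / 2 ≤ (⌊w ^ 4⌋₊ : ℝ) := by
    have := (Nat.sub_one_lt_floor (w ^ 4)).le
    linarith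
  have hbase : 1 - (1 / w) ^ 2 / 2 ≤ Real.exp (-(1 / (2 * w ^ 2))) := by
    have := Real.add_one_le_exp (-(1 / (2 * w ^ 2)))
    have e : (1 / w) ^ 2 / 2 = 1 / (2 * w ^ 2) := by field_simp
    linarith
  have hbase0 : 0 ≤ 1 - (1 / w) ^ 2 / 2 := by
    have : 1 / w ≤ 1 := by rw [div_le_one hw0]; linarith
    have : (1 / w) ^ 2 ≤ 1 := pow_le_one₀ (by positivity) this
    linarith
  refine (pow_le_pow_left₀ hbase0 hbase _).trans ?_
  rw [← Real.exp_nat_mul, Real.exp_le_exp]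
  have h := mul_le_mul_of_nonneg_right hK (show (0 : ℝ) ≤ 1 / (2 * w ^ 2) by positivity)
  have e : w ^ 4 / 2 * (1 / (2 * w ^ 2)) = w ^ 2 / 4 := by field_simp; norm_num
  linarith

/-- One of the two alternatives of `exists_sparse_of_concentrated` holds, with `E` in the place of
`(1 - φ ^ 2 / 2) ^ K`, `F = 1 / (4 * N)`, `B = N / N ^ i` and `θ = 1 / N ^ (i + 6)`. If `n` exceeds
`N ^ (i + 4)`, the factor `2 ^ i` in the walk length is absorbed by `N`, and the first one holds.
Otherwise `θ * n` is small, and the second one does. -/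
theorem concentrated_of_large {n i ℓ : ℕ} {N E x : ℝ} (hN : 1000 ≤ N) (hn : 1 ≤ n)
    (hE0 : 0 ≤ E) (hE : 4 * n * N ^ 2 * E ≤ 1) (hi : N ^ (i + 4) < n → 64 * 2 ^ i ≤ N)
    (hℓ : (ℓ : ℝ) ≤ 2 * N ^ 5) (hx : 1 / N ^ i ≤ x) :
    N / N ^ i * (1 / (4 * N)) + ((2 ^ (i + 1) * ℓ : ℕ) : ℝ) * (E + 1 / N ^ (i + 6)) < x ∨
      E * √(n : ℝ) + 1 / N ^ (i + 6) * n < 1 - 1 / (4 * N) := by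
  have hN0 : 0 < N := by linarith
  have hNi : 0 < N ^ i := pow_pos hN0 i
  have hn1 : (1 : ℝ) ≤ n := by exact_mod_cast hn
  rcases lt_or_ge (N ^ (i + 4)) (n : ℝ) with h | h
  · left
    have h2i := hi h
    have hL : ((2 ^ (i + 1) * ℓ : ℕ) : ℝ) ≤ N ^ 6 / 16 := by
      push_cast
      have : (2 : ℝ) ^ (i + 1) ≤ N / 32 := by rw [pow_succ]; linarith
      calc (2 : ℝ) ^ (i + 1) * ℓ ≤ N / 32 * (2 * N ^ 5) :=
            mul_le_mul this hℓ (Nat.cast_nonneg _) (by positivity)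
        _ = N ^ 6 / 16 := by ring
    have hE' : N ^ 6 * E ≤ 1 / N ^ i / 4 := by
      rw [div_div, le_div_iff₀ (by positivity)]
      have h1 : N ^ (i + 4) * (4 * N ^ 2 * E) ≤ n * (4 * N ^ 2 * E) :=
        mul_le_mul_of_nonneg_right h.le (by positivity)
      have e : N ^ 6 * E * (N ^ i * 4) = N ^ (i + 4) * (4 * N ^ 2 * E) := by ring
      rw [e]
      linarith
    have hθ : N ^ 6 * (1 / N ^ (i + 6)) = 1 / N ^ i := by
      rw [pow_add]
      field_simp
    have hB : N / N ^ i * (1 / (4 * N)) = 1 / N ^ i / 4 := by field_simp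
    have hpos : 0 < 1 / N ^ i := by positivity
    have h3 := mul_le_mul_of_nonneg_right hL
      (show 0 ≤ E + 1 / N ^ (i + 6) by positivity)
    rw [hB]
    have e : N ^ 6 / 16 * (E + 1 / N ^ (i + 6)) =
        (N ^ 6 * E + N ^ 6 * (1 / N ^ (i + 6))) / 16 := by ring
    rw [e, hθ] at h3
    linarith
  · right
    have hsq : √(n : ℝ) ≤ n := by
      rw [Real.sqrt_le_left (by linarith)]
      nlinarith
    have h1 : E * √(n : ℝ) ≤ 1 / 4 := by
      have hmul : E * √(n : ℝ) ≤ E * n := mul_le_mul_of_nonneg_left hsq hE0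
      have hN2 : 1 ≤ N ^ 2 := one_le_pow₀ (by linarith)
      have : E * n ≤ E * n * N ^ 2 := le_mul_of_one_le_right (by positivity) hN2
      linarith
    have h2 : 1 / N ^ (i + 6) * n ≤ 1 / 4 := by
      rw [div_mul_eq_mul_div, one_mul, div_le_iff₀ (by positivity)]
      have e : N ^ (i + 6) = N ^ (i + 4) * N ^ 2 := by ring
      have h4 : 4 ≤ N ^ 2 := by nlinarith
      have : n * 4 ≤ N ^ (i + 4) * N ^ 2 :=
        mul_le_mul h h4 (by norm_num) (by positivity)
      rw [e]
      linarith
    have h3 : 1 / (4 * N) ≤ 1 / 4 := by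
      rw [div_le_div_iff₀ (by positivity) (by norm_num)]
      linarith
    linarith

/-- From at least `α * |V| / 2` vertices of `S'`, the walk is unlikely to visit `S` fewer than `K`
times: otherwise Kac's formula would be violated. -/
theorem card_filter_fewVisits_ge {V : Type*} [Fintype V] [DecidableEq V] {M : Matrix V V ℝ}
    (hM0 : ∀ u v, 0 ≤ M u v) (hMs : M.transpose = M) (hM1 : M.mulVec 1 = 1) {S S' : Finset V}
    (hS' : S' ⊆ S) {K ℓ : ℕ} {N α : ℝ} (hN : 1000 ≤ N) (hK : (K : ℝ) ≤ N)
    (hℓ : N ^ 5 / 2 ≤ ℓ) (hα : 1 / N ≤ α) (hcard : α * Fintype.card V ≤ S'.card) :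
    α * Fintype.card V / 2 ≤
      (S'.filter fun s => fewVisits M S K ℓ s ≤ 1 / (4 * N)).card := by
  have hN0 : 0 < N := by linarith
  set n : ℝ := (Fintype.card V : ℝ) with hn
  have hn0 : 0 ≤ n := Nat.cast_nonneg _
  set bad := S'.filter fun s => ¬ fewVisits M S K ℓ s ≤ 1 / (4 * N) with hbad
  have h1 : (bad.card : ℝ) * (1 / (4 * N)) ≤ ∑ s ∈ S, fewVisits M S K ℓ s := by
    have h2 : ∑ s ∈ bad, (1 / (4 * N)) ≤ ∑ s ∈ bad, fewVisits M S K ℓ s :=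
      Finset.sum_le_sum fun s hs => (not_le.1 (Finset.mem_filter.1 hs).2).le
    rw [Finset.sum_const, nsmul_eq_mul] at h2
    exact h2.trans (Finset.sum_le_sum_of_subset_of_nonneg
      ((Finset.filter_subset _ S').trans hS') fun s _ _ => fewVisits_nonneg S hM0 K ℓ s)
  have hkac := mul_sum_fewVisits_le S hM0 hMs hM1 K ℓ
  rw [← hn] at hkac
  have hb0 : (0 : ℝ) ≤ bad.card := Nat.cast_nonneg _
  have h3 : N ^ 5 / 2 * (bad.card * (1 / (4 * N))) ≤ N * n :=
    (mul_le_mul hℓ h1 (by positivity) (Nat.cast_nonneg _)).trans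
      (hkac.trans (mul_le_mul_of_nonneg_right hK hn0))
  have h4 : (bad.card : ℝ) * N ^ 3 ≤ 8 * n := by
    have e : N ^ 5 / 2 * ((bad.card : ℝ) * (1 / (4 * N))) = N * (bad.card * N ^ 3) / 8 := by
      field_simp
      ring
    rw [e] at h3
    have : N * (bad.card * N ^ 3) ≤ N * (8 * n) := by linarith
    exact le_of_mul_le_mul_left this hN0
  have h5 : (bad.card : ℝ) ≤ α * n / 2 := by
    have h6 : 1 / N * n ≤ α * n := mul_le_mul_of_nonneg_right hα hn0
    have h7 : (bad.card : ℝ) ≤ 1 / N * n / 2 := by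
      have hN2 : 16 ≤ N ^ 2 := by nlinarith
      have h8 : (bad.card * N) * 16 ≤ (bad.card * N) * N ^ 2 :=
        mul_le_mul_of_nonneg_left hN2 (by positivity)
      rw [one_div_mul_eq_div, div_div, le_div_iff₀ (by positivity)]
      have e : (bad.card : ℝ) * N * N ^ 2 = bad.card * N ^ 3 := by ring
      linarith
    linarith
  have h9 : ((S'.filter fun s => fewVisits M S K ℓ s ≤ 1 / (4 * N)).card : ℝ) + bad.card =
      S'.card := by
    exact_mod_cast Finset.card_filter_add_card_filter_not (s := S') _
  linarith

end LocalPartition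

theorem mainTheorem4 (δ : ℝ) (hδ : 0 < δ) :
    ∃ n₀ : ℕ, ∀ n : ℕ, n₀ ≤ n →
      ∀ (d : ℕ) (G : SimpleGraph (Fin n)) [DecidableRel G.Adj],
      0 < d → (∀ v, G.degree v ≤ d) →
      ∀ ℓ : ℕ, (ℓ = ⌊(n : ℝ) ^ (5 * δ)⌋₊ ∨ ℓ = ⌈(n : ℝ) ^ (5 * δ)⌉₊) →
      ∀ α : ℝ, (n : ℝ) ^ (-δ / 2) ≤ α →
      ∀ (i : ℕ) (S : Finset (Fin n)),
      (∀ s ∈ S, LocalPartition.returnNormSq G d ℓ S i s ≤ 1 / (n : ℝ) ^ (δ * ((i : ℝ) - 1))) →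
      ∀ S' : Finset (Fin n),
      S' = S.filter (fun s =>
        1 / (n : ℝ) ^ (δ * (i : ℝ)) ≤ LocalPartition.returnNormSq G d ℓ S (i + 1) s) →
      α * n ≤ (S'.card : ℝ) →
      ∃ T : Finset (Fin n), T ⊆ S' ∧ α * n / 8 ≤ (T.card : ℝ) ∧
        ∀ s ∈ T, ∃ P : Finset (Fin n), P ⊆ S ∧ P.Nonempty ∧
          ((G.interedges P (S \ P)).card : ℝ) ≤ 2 * (n : ℝ) ^ (-δ / 4) * d * (P.card : ℝ) ∧
          ∀ v ∈ P, ∃ t : ℕ, (t : ℝ) ≤ 160 * (n : ℝ) ^ (δ * ((i : ℝ) + 7)) / α ∧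
            α / (n : ℝ) ^ (δ * (2 * (i : ℝ) + 14)) ≤ LocalPartition.reachProb G d t s v := by
  obtain ⟨n₀, hn₀⟩ := Filter.eventually_atTop.1 (LocalPartition.eventually_large δ hδ)
  refine ⟨n₀, fun n hn d G _ hd hdeg ℓ hℓ α hα i S hS S' hS' hcard => ?_⟩
  obtain ⟨hn1, hN, hN2, hexp⟩ := hn₀ n hn
  have hn0 : (0 : ℝ) < n := by exact_mod_cast hn1
  -- All powers of `n` in the statement are integer powers of `N = n ^ δ` or of `w = n ^ (δ / 4)`.
  set N : ℝ := (n : ℝ) ^ δ with hNdef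
  set w : ℝ := (n : ℝ) ^ (δ / 4) with hwdef
  have hN0 : 0 < N := by linarith
  have hw0 : 0 < w := Real.rpow_pos_of_pos hn0 _
  have hwN : w ^ 4 = N := by
    rw [hwdef, hNdef, ← Real.rpow_natCast, ← Real.rpow_mul hn0.le]
    congr 1
    push_cast
    ring
  have hw2 : 2 ≤ w := by
    by_contra hlt
    have := pow_le_pow_left₀ hw0.le (not_le.1 hlt).le 4
    rw [hwN] at this
    linarith
  have e1 : (n : ℝ) ^ (-δ / 4) = 1 / w := by
    rw [neg_div, Real.rpow_neg hn0.le, one_div]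
  have e2 : (n : ℝ) ^ (-δ / 2) = 1 / w ^ 2 := by
    rw [neg_div, Real.rpow_neg hn0.le, one_div, hwdef, ← Real.rpow_natCast,
      ← Real.rpow_mul hn0.le]
    congr 2
    push_cast
    ring
  have epow : ∀ k : ℕ, (n : ℝ) ^ (δ * (k : ℝ)) = N ^ k := fun k => by
    rw [Real.rpow_mul hn0.le, Real.rpow_natCast]
  have e3 : (n : ℝ) ^ (δ * ((i : ℝ) - 1)) = N ^ i / N := by
    rw [mul_sub, Real.rpow_sub hn0, epow, mul_one]
  have e4 : (n : ℝ) ^ (δ * ((i : ℝ) + 7)) = N ^ (i + 7) := by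
    rw [← epow]
    push_cast
    rfl
  have e5 : (n : ℝ) ^ (δ * (2 * (i : ℝ) + 14)) = N ^ (2 * i + 14) := by
    rw [← epow]
    push_cast
    rfl
  have e6 : (n : ℝ) ^ (5 * δ) = N ^ 5 := by
    rw [← epow, mul_comm]
    push_cast
    rfl
  rw [e3] at hS
  rw [epow] at hS'
  rw [e6] at hℓ
  rw [e2] at hα
  rw [e1, e4, e5]
  have hα0 : 0 < α := lt_of_lt_of_le (by positivity) hα
  have hαN : 1 / N ≤ α := by
    refine le_trans ?_ hα
    rw [← hwN]
    exact one_div_le_one_div_of_le (by positivity)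
      (pow_le_pow_right₀ (by linarith) (by norm_num))
  have hS'S : S' ⊆ S := hS' ▸ Finset.filter_subset _ S
  have hα1 : α ≤ 1 := by
    have h1 : (S'.card : ℝ) ≤ n := by
      exact_mod_cast (Finset.card_le_univ S').trans_eq (Fintype.card_fin n)
    exact le_of_mul_le_mul_right (by linarith : α * n ≤ 1 * n) hn0
  have hN5 : 2 ≤ N ^ 5 := by
    have := pow_le_pow_left₀ (by norm_num) hN 5
    linarith
  have hℓ1 : N ^ 5 / 2 ≤ ℓ := by
    rcases hℓ with rfl | rfl
    · linarith [Nat.sub_one_lt_floor (N ^ 5)]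
    · linarith [Nat.le_ceil (N ^ 5)]
  have hℓ2 : (ℓ : ℝ) ≤ 2 * N ^ 5 := by
    rcases hℓ with rfl | rfl
    · linarith [Nat.floor_le (by positivity : 0 ≤ N ^ 5)]
    · linarith [Nat.ceil_lt_add_one (by positivity : 0 ≤ N ^ 5)]
  have hℓ0 : 0 < ℓ := by
    have : (0 : ℝ) < ℓ := by linarith
    exact_mod_cast this
  set K := ⌊N⌋₊ with hK
  have hK0 : 0 < K := Nat.floor_pos.2 (by linarith)
  have hKN : (K : ℝ) ≤ N := Nat.floor_le hN0.le
  set M := LocalPartition.walkMatrix G d with hM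
  -- The bound on the walk length; the excursions are cut off at `⌊τ⌋`.
  set τ := 160 * N ^ (i + 7) / α with hτ
  have hτ1 : 160 * N ^ (i + 7) ≤ τ := by
    rw [hτ, le_div_iff₀ hα0]
    exact mul_le_of_le_one_right (by positivity) hα1
  refine ⟨S'.filter fun s => LocalPartition.fewVisits M S K ℓ s ≤ 1 / (4 * N),
    Finset.filter_subset _ _, ?_, fun s hs => ?_⟩
  · have h := LocalPartition.card_filter_fewVisits_ge (α := α)
      (LocalPartition.walkMatrix_nonneg hd hdeg) LocalPartition.walkMatrix_transpose
      LocalPartition.walkMatrix_mulVec_one hS'S hN hKN hℓ1 hαN (by simpa using hcard)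
    rw [Fintype.card_fin] at h
    have : 0 ≤ α * n := by positivity
    linarith
  obtain ⟨hsS', hfew⟩ := Finset.mem_filter.1 hs
  have hsS := hS'S hsS'
  rw [hS'] at hsS'
  have hconc := (Finset.mem_filter.1 hsS').2
  have hLT : 2 ^ (i + 1) * ℓ ≤ ⌊τ⌋₊ := by
    refine Nat.le_floor (le_trans ?_ hτ1)
    push_cast
    have h2 : (2 : ℝ) ^ (i + 1) ≤ N ^ (i + 1) :=
      pow_le_pow_left₀ (by norm_num) (by linarith) _
    calc (2 : ℝ) ^ (i + 1) * ℓ ≤ N ^ (i + 1) * (2 * N ^ 5) :=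
          mul_le_mul h2 hℓ2 (Nat.cast_nonneg _) (by positivity)
      _ = 2 * N ^ (i + 6) := by ring
      _ ≤ 160 * N ^ (i + 7) := by
          have : N ^ (i + 6) ≤ N ^ (i + 7) := pow_le_pow_right₀ (by linarith) (by omega)
          have : 0 < N ^ (i + 6) := by positivity
          linarith
  have hηθ : ((⌊τ⌋₊ : ℝ) + 1) * (α / N ^ (2 * i + 14)) ≤ 1 / N ^ (i + 6) := by
    have h1 : (⌊τ⌋₊ : ℝ) + 1 ≤ 161 * N ^ (i + 7) / α := by
      have h2 := Nat.floor_le (by positivity : 0 ≤ τ)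
      have h3 : 1 ≤ N ^ (i + 7) / α := by
        rw [le_div_iff₀ hα0, one_mul]
        exact hα1.trans (one_le_pow₀ (by linarith))
      have e : 161 * N ^ (i + 7) / α = τ + N ^ (i + 7) / α := by rw [hτ]; ring
      linarith
    refine (mul_le_mul_of_nonneg_right h1 (by positivity)).trans ?_
    have e : 161 * N ^ (i + 7) / α * (α / N ^ (2 * i + 14)) =
        161 / N * (1 / N ^ (i + 6)) := by
      have e' : N ^ (2 * i + 14) = N ^ (i + 7) * N * N ^ (i + 6) := by ring
      rw [e']
      field_simp
    rw [e]
    refine mul_le_of_le_one_left (by positivity) ?_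
    rw [div_le_one hN0]
    linarith
  have hi : N ^ (i + 4) < n → 64 * (2 : ℝ) ^ i ≤ N := by
    intro hlt
    have h1 : (n : ℝ) ^ (δ * i) < (n : ℝ) ^ (1 : ℝ) := by
      rw [epow, Real.rpow_one]
      exact lt_of_le_of_lt (pow_le_pow_right₀ (by linarith) (by omega)) hlt
    have h2 : δ * i < 1 := by
      by_contra hge
      exact absurd h1 (not_lt.2
        (Real.rpow_le_rpow_of_exponent_le (by exact_mod_cast hn1) (not_lt.1 hge)))
    have h3 : (2 : ℝ) ^ i ≤ (2 : ℝ) ^ (1 / δ) := by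
      rw [← Real.rpow_natCast]
      refine Real.rpow_le_rpow_of_exponent_le (by norm_num) ?_
      rw [le_div_iff₀ hδ, mul_comm]
      exact h2.le
    linarith
  have hE0 : (0 : ℝ) ≤ (1 - (1 / w) ^ 2 / 2) ^ K := by
    refine pow_nonneg ?_ K
    have h1 : (1 / w) ^ 2 ≤ 1 := pow_le_one₀ (by positivity) (by
      rw [div_le_one hw0]
      linarith)
    linarith
  have hE : 4 * n * N ^ 2 * (1 - (1 / w) ^ 2 / 2) ^ K ≤ 1 := by
    refine le_trans (mul_le_mul_of_nonneg_left ?_ (by positivity)) hexp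
    rw [hK, ← hwN]
    exact LocalPartition.pow_floor_le_exp hw2
  obtain ⟨P, hPS, hPne, hPcut, hPreach⟩ := LocalPartition.exists_sparse_of_concentrated
    (i := i) (φ := 1 / w) (θ := 1 / N ^ (i + 6)) (η := α / N ^ (2 * i + 14)) (B := N / N ^ i)
    (F := 1 / (4 * N)) hd hdeg hsS hK0 hLT hℓ0
    (fun v hv => (LocalPartition.returnProb_succ_le hℓ0 hS hsS hv).trans_eq (one_div_div _ _))
    hfew (by positivity) (by positivity) (by rw [div_le_one hw0]; linarith) (by positivity)
    hηθ (by
      simpa using LocalPartition.concentrated_of_large hN hn1 hE0 hE hi hℓ2 hconc)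
  refine ⟨P, hPS, hPne, hPcut, fun v hv => ?_⟩
  obtain ⟨t, ht, hreach⟩ := hPreach v hv
  exact ⟨t, (Nat.cast_le.2 ht).trans (Nat.floor_le (by positivity)), hreach⟩
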